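/- For $\delta>0$ let $y=y_\delta$ be the solution of the Duffing problem $\ddot y+y+y^3=0$, $y(0)=\delta$, $\dot y(0)=0$, and for $\gamma\in\mathbb R$ consider the Hill equation $$\ddot\xi(t)+\big(\gamma+y_\delta(t)^2\big)\,\xi(t)=0. \qquad (1)$$ Let $\tau(\delta)$ be the smallest period of $y_\delta^2$. For $\ell\in\mathbb N$, let $U_\ell$ (the resonance tongue emanating from $(\delta,\gamma)=(0,\ell^2)$) be the set of all $(\delta,\gamma)$ with $\delta>0$ for which (1) has a real solution $\xi\not\equiv0$ with $\xi(t+\tau(\delta))=c\,\xi(t)$ for all $t$, for some real $c$ with $|c|\ne1$, and with exactly $\ell$ zeros in $[0,\tau(\delta))$. Let $L_\ell$ (the resonance lines of $U_\ell$) be the set of all $(\delta,\gamma)$ with $\delta>0$ satisfying the same condition with $|c|=1$ instead of $|c|\neq 1$. (a) For every integer $\ell\ge2$ there are constants $C>0$ and $\delta_0>0$ such that, for all $(\delta,\gamma)\in U_\ell\cup L_\ell$ with $0<\delta<\delta_0$, $$\ell^2+\Big(\frac{3\ell^2}{4}-\frac12-\frac1{\pi\ell}\Big)\delta^2-C\delta^4\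 \le\ \gamma\ \le\ \ell^2+\Big(\frac{3\ell^2}{4}-\frac12+\frac1{\pi\ell}\Big)\delta^2+C\delta^4 .$$ (b) For every $\gamma\ge0$ with $\gamma\ne1$ there is $\delta_\gamma>0$ such that, for all $0<\delta<\delta_\gamma$, the trivial solution $\xi\equiv0$ of (1) is stable: for every $\varepsilon>0$ there is $\eta>0$ such that every solution of (1) with $|\xi(0)|<\eta$ and $|\dot\xi(0)|<\eta$ satisfies $|\xi(t)|<\varepsilon$ and $|\dot\xi(t)|<\varepsilon$ for all $t\in\mathbb R$. -/

import Mathlib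

open Set

/-- `y : ℝ → ℝ` is the solution of the Duffing problem
`y'' + y + y³ = 0`, `y(0) = δ`, `y'(0) = 0`. -/
structure IsDuffingSolution (δ : ℝ) (y : ℝ → ℝ) : Prop where
  differentiable : Differentiable ℝ y
  ode : ∀ t, HasDerivAt (deriv y) (-(y t + y t ^ 3)) t
  init : y 0 = δ
  init_deriv : deriv y 0 = 0

/-- `ξ : ℝ → ℝ` solves the Hill equation `ξ'' + p(t) ξ = 0` on the whole line. -/
structure IsHillSolution (p ξ : ℝ → ℝ) : Prop where
  differentiable : Differentiable ℝ ξ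
  ode : ∀ t, HasDerivAt (deriv ξ) (-(p t * ξ t)) t

/-- The trivial solution of `ξ'' + p(t) ξ = 0` is stable (in the sense of Lyapunov): solutions that
start close to `(0, 0)` in the phase plane stay close to it for all times. -/
def TrivialSolutionStable (p : ℝ → ℝ) : Prop :=
  ∀ ε > 0, ∃ η > 0, ∀ ξ : ℝ → ℝ, IsHillSolution p ξ → |ξ 0| < η → |deriv ξ 0| < η →
    ∀ t, |ξ t| < ε ∧ |deriv ξ t| < ε

/-- `T > 0` is the smallest period of `p`. -/
def IsSmallestPeriod (p : ℝ → ℝ) (T : ℝ) : Prop :=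
  IsLeast {τ : ℝ | 0 < τ ∧ Function.Periodic p τ} T

/-- `ξ` is a nontrivial Floquet solution of `ξ'' + p(t) ξ = 0` with real multiplier `c`, that is
`ξ(t + T) = c ξ(t)` with `T` the smallest period of `p`, and it has exactly `ℓ` zeros in each
period. -/
def IsFloquetSolution (p : ℝ → ℝ) (ℓ : ℕ) (c : ℝ) (ξ : ℝ → ℝ) : Prop :=
  IsHillSolution p ξ ∧ ξ ≠ 0 ∧
    ∃ T, IsSmallestPeriod p T ∧ (∀ t, ξ (t + T) = c * ξ t) ∧
      {t ∈ Ico 0 T | ξ t = 0}.encard = ℓ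

/-- The `ℓ`-th resonance tongue (instability region) `U_ℓ` in the `(δ, γ)`-half-plane `δ > 0` of
`ξ'' + (γ + y(t)²) ξ = 0`, where `y` is the Duffing solution with `y(0) = δ`, `y'(0) = 0`:
the Floquet multipliers are real and off the unit circle, and the corresponding solutions have `ℓ`
zeros per period of the coefficient. In the limit `δ → 0` the coefficient is the constant `γ` and
its period is `π`, so that `ℓ` zeros per period with a real multiplier means `γ = ℓ²`:
this is the tongue that emanates from `(0, ℓ²)`. -/
def resonanceTongue (ℓ : ℕ) : Set (ℝ × ℝ) :=
  {q | 0 < q.1 ∧ ∃ y, IsDuffingSolution q.1 y ∧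
    ∃ c ξ, |c| ≠ 1 ∧ IsFloquetSolution (fun t => q.2 + y t ^ 2) ℓ c ξ}

/-- The resonance lines of the `ℓ`-th tongue, which separate it from the stability regions: there
is a Floquet solution with multiplier `1` or `-1` (a periodic or antiperiodic solution) having `ℓ`
zeros per period of the coefficient. They may coincide, and then the tongue is degenerate. -/
def resonanceLines (ℓ : ℕ) : Set (ℝ × ℝ) :=
  {q | 0 < q.1 ∧ ∃ y, IsDuffingSolution q.1 y ∧
    ∃ c ξ, |c| = 1 ∧ IsFloquetSolution (fun t => q.2 + y t ^ 2) ℓ c ξ}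

/-!
The zeros of a Floquet solution `ξ` of `ξ'' + (γ + y²) ξ = 0` with a real multiplier are invariant
under the translation by the period `T` of `y²`. So if `ξ` has a zero `a`, then it solves a
Dirichlet problem on `[a, a + T]`, and both parts follow from the expansion of the Dirichlet
eigenvalues for `δ → 0`.

That expansion rests on one orthogonality relation: if `p - k²` is small, then a solution of
`ξ'' + p ξ = 0` that vanishes at both ends of an interval of length `ℓ π / k` is close to a
multiple of `sin (k (t - a))`, and as `p - k²` is orthogonal to the product of the two, it is
orthogonal to `sin² (k (t - a))` up to a quadratic error
(`IsHillSolution.abs_integral_mul_sin_sq_le`). It is used twice, with `ω = π / T`.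
The velocity `y'` is a Dirichlet solution of the variational equation with `p = 1 + 3 y²`
on `[0, T]`, which gives `ω² = 1 + 3 δ² / 4 + O(δ⁴)`
(`IsDuffingSolution.abs_frequency_sq_sub_le`). For `p = γ + y²` and `ℓ ≥ 2`, the harmonic
`cos (2 ω t)` of `y² = δ² cos² (ω t) + O(δ⁴)` does not resonate with `sin² (ℓ ω (t - a))`, whatever
`a` is, and hence `γ = ℓ² ω² - δ² / 2 + O(δ⁴)`
(`IsDuffingSolution.abs_dirichlet_eigenvalue_sub_le`). In particular, both resonance lines have the
same expansion to order `δ²`.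

For the bounds on the tongues, Sturm comparison with constant coefficients turns the number of
zeros per period into the a priori bound `ℓ² ω² - δ² ≤ γ ≤ ℓ² ω²`.

For stability, it suffices to exclude Floquet solutions with real multipliers
(`IsHillSolution.trivialSolutionStable`): the Wronskian of a solution and its translate is then a
definite quadratic form that is invariant under the translation. As `γ + y² ≥ 0`, every solution
has a zero, so that only Dirichlet solutions on `[a, a + T]` have to be excluded for small `δ`. If
`γ` is not the square of an integer, then none exists even in the limit, and for `γ = 0` there is
none by Sturm comparison. For `γ = ℓ²` with `ℓ ≥ 2`, the coefficient `3 ℓ² / 4 - 1 / 2` in the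
expansion does not vanish.
-/

/-! ### Solutions of the Hill equation: linear structure and uniqueness -/

namespace IsHillSolution

variable {p q ξ η : ℝ → ℝ}

theorem of_hasDerivAt (h : ∀ t, HasDerivAt ξ (η t) t)
    (h' : ∀ t, HasDerivAt η (-(p t * ξ t)) t) : IsHillSolution p ξ ∧ deriv ξ = η := by
  have e : deriv ξ = η := funext fun t => (h t).deriv
  exact ⟨⟨fun t => (h t).differentiableAt, e ▸ h'⟩, e⟩

theorem hasDerivAt (h : IsHillSolution p ξ) (t : ℝ) : HasDerivAt ξ (deriv ξ t) t :=
  (h.differentiable t).hasDerivAt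

theorem continuous (h : IsHillSolution p ξ) : Continuous ξ := h.differentiable.continuous

theorem const_mul (h : IsHillSolution p ξ) (c : ℝ) :
    IsHillSolution p (fun t => c * ξ t) ∧
      deriv (fun t => c * ξ t) = fun t => c * deriv ξ t :=
  of_hasDerivAt (fun t => (h.hasDerivAt t).const_mul c)
    fun t => ((h.ode t).const_mul c).congr_deriv (by ring)

theorem add (h : IsHillSolution p ξ) (h' : IsHillSolution p η) :
    IsHillSolution p (fun t => ξ t + η t) ∧
      deriv (fun t => ξ t + η t) = fun t => deriv ξ t + deriv η t :=
  of_hasDerivAt (fun t => (h.hasDerivAt t).add (h'.hasDerivAt t))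
    fun t => ((h.ode t).add (h'.ode t)).congr_deriv (by ring)

theorem shift (h : IsHillSolution p ξ) {T : ℝ} (hT : Function.Periodic p T) :
    IsHillSolution p (fun t => ξ (t + T)) ∧
      deriv (fun t => ξ (t + T)) = fun t => deriv ξ (t + T) :=
  of_hasDerivAt (fun t => (h.hasDerivAt (t + T)).comp_add_const t T)
    fun t => ((h.ode (t + T)).comp_add_const t T).congr_deriv (by rw [hT t])

/-- Grönwall's inequality for the phase-plane norm `ξ² + ξ'²`. -/
theorem sq_add_sq_le (h : IsHillSolution p ξ) {K : ℝ} (hK : ∀ t, |p t| ≤ K) {s t : ℝ}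
    (hst : s ≤ t) :
    ξ t ^ 2 + deriv ξ t ^ 2 ≤ (ξ s ^ 2 + deriv ξ s ^ 2) * Real.exp ((1 + K) * (t - s)) ∧
    ξ s ^ 2 + deriv ξ s ^ 2 ≤ (ξ t ^ 2 + deriv ξ t ^ 2) * Real.exp ((1 + K) * (t - s)) := by
  have hE : ∀ r, HasDerivAt (fun r => ξ r ^ 2 + deriv ξ r ^ 2)
      (2 * (ξ r * deriv ξ r) * (1 - p r)) r := fun r =>
    (((h.hasDerivAt r).pow 2).add ((h.ode r).pow 2)).congr_deriv (by push_cast; ring)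
  have hbound : ∀ r, |2 * (ξ r * deriv ξ r) * (1 - p r)| ≤
      (1 + K) * (ξ r ^ 2 + deriv ξ r ^ 2) := fun r => by
    have h1 : |2 * (ξ r * deriv ξ r)| ≤ ξ r ^ 2 + deriv ξ r ^ 2 := abs_le.2
      ⟨by nlinarith [sq_nonneg (ξ r + deriv ξ r)], by nlinarith [sq_nonneg (ξ r - deriv ξ r)]⟩
    have h2 : |1 - p r| ≤ 1 + K := by
      have := abs_le.1 (hK r)
      exact abs_le.2 ⟨by linarith, by linarith⟩
    rw [abs_mul, mul_comm]
    exact mul_le_mul h2 h1 (abs_nonneg _) ((abs_nonneg _).trans h2)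
  have hexp : ∀ c r : ℝ, HasDerivAt (fun r => Real.exp (c * r)) (Real.exp (c * r) * c) r :=
    fun c r => ((hasDerivAt_id r).const_mul c).exp.congr_deriv (by simp)
  have hup : Monotone fun r => (ξ r ^ 2 + deriv ξ r ^ 2) * Real.exp ((1 + K) * r) := by
    have hd : ∀ r, HasDerivAt (fun r => (ξ r ^ 2 + deriv ξ r ^ 2) * Real.exp ((1 + K) * r)) _ r :=
      fun r => (hE r).mul (hexp (1 + K) r)
    refine monotone_of_deriv_nonneg (fun r => (hd r).differentiableAt) fun r => ?_
    rw [(hd r).deriv]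
    nlinarith [(abs_le.1 (hbound r)).1, Real.exp_pos ((1 + K) * r)]
  have hdown : Antitone fun r => (ξ r ^ 2 + deriv ξ r ^ 2) * Real.exp (-(1 + K) * r) := by
    have hd : ∀ r, HasDerivAt (fun r => (ξ r ^ 2 + deriv ξ r ^ 2) * Real.exp (-(1 + K) * r)) _ r :=
      fun r => (hE r).mul (hexp (-(1 + K)) r)
    refine antitone_of_deriv_nonpos (fun r => (hd r).differentiableAt) fun r => ?_
    rw [(hd r).deriv]
    nlinarith [(abs_le.1 (hbound r)).2, Real.exp_pos (-(1 + K) * r)]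
  constructor
  · have := mul_le_mul_of_nonneg_right (hdown hst) (Real.exp_pos ((1 + K) * t)).le
    simp only [mul_assoc, ← Real.exp_add] at this
    rwa [show -(1 + K) * t + (1 + K) * t = 0 by ring, Real.exp_zero, mul_one,
      show -(1 + K) * s + (1 + K) * t = (1 + K) * (t - s) by ring] at this
  · have := mul_le_mul_of_nonneg_right (hup hst) (Real.exp_pos (-(1 + K) * s)).le
    simp only [mul_assoc, ← Real.exp_add] at this
    rwa [show (1 + K) * s + -(1 + K) * s = 0 by ring, Real.exp_zero, mul_one,
      show (1 + K) * t + -(1 + K) * s = (1 + K) * (t - s) by ring] at this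

theorem eq_zero (h : IsHillSolution p ξ) {K : ℝ} (hK : ∀ t, |p t| ≤ K) {a : ℝ}
    (ha : ξ a = 0) (ha' : deriv ξ a = 0) : ξ = 0 := by
  funext t
  have : ξ t ^ 2 + deriv ξ t ^ 2 ≤ 0 := by
    rcases le_total a t with hat | hat
    · simpa [ha, ha'] using (h.sq_add_sq_le hK hat).1
    · simpa [ha, ha'] using (h.sq_add_sq_le hK hat).2
  have h0 : ξ t ^ 2 = 0 := le_antisymm (by nlinarith [sq_nonneg (deriv ξ t)]) (sq_nonneg _)
  simpa using h0

theorem deriv_ne_zero (h : IsHillSolution p ξ) {K : ℝ} (hK : ∀ t, |p t| ≤ K) (h0 : ξ ≠ 0)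
    {a : ℝ} (ha : ξ a = 0) : deriv ξ a ≠ 0 := fun ha' => h0 (h.eq_zero hK ha ha')

/-- The Wronskian of two solutions is constant. -/
theorem wronskian_eq (h : IsHillSolution p ξ) (h' : IsHillSolution p η) (s t : ℝ) :
    ξ s * deriv η s - deriv ξ s * η s = ξ t * deriv η t - deriv ξ t * η t := by
  have hd : ∀ r, HasDerivAt (fun r => ξ r * deriv η r - deriv ξ r * η r) 0 r := fun r =>
    (((h.hasDerivAt r).mul (h'.ode r)).sub ((h.ode r).mul (h'.hasDerivAt r))).congr_deriv
      (by ring)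
  exact is_const_of_deriv_eq_zero (fun r => (hd r).differentiableAt) (fun r => (hd r).deriv) s t

/-! ### Sturm comparison with constant coefficients -/

/-- **Sturm comparison**: where `p ≤ M²`, distinct zeros are at least `π / M` apart. With
`φ(t) = cos (M (t - (a + b) / 2))` positive on `[a, b]`, the function `φ² (u²)' / 2` of the quotient
`u = ξ / φ` would be nondecreasing with zero boundary values, so that `u` would vanish. -/
theorem pi_le_mul_sub (h : IsHillSolution p ξ) {K : ℝ} (hK : ∀ t, |p t| ≤ K) (h0 : ξ ≠ 0)
    {M a b : ℝ} (hM : 0 ≤ M) (hp : ∀ t, p t ≤ M ^ 2) (hab : a < b) (ha : ξ a = 0)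
    (hb : ξ b = 0) : Real.pi ≤ M * (b - a) := by
  by_contra! hlt
  set φ : ℝ → ℝ := fun t => Real.cos (M * (t - (a + b) / 2)) with hφ
  set φ' : ℝ → ℝ := fun t => -(M * Real.sin (M * (t - (a + b) / 2))) with hφ'
  have hlin : ∀ t, HasDerivAt (fun t => M * (t - (a + b) / 2)) M t := fun t => by
    simpa using ((hasDerivAt_id t).sub_const ((a + b) / 2)).const_mul M
  have hdφ : ∀ t, HasDerivAt φ (φ' t) t := fun t =>
    (hlin t).cos.congr_deriv (by simp only [hφ']; ring)
  have hdφ' : ∀ t, HasDerivAt φ' (-(M ^ 2 * φ t)) t := fun t =>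
    ((hlin t).sin.const_mul M).neg.congr_deriv (by simp only [hφ]; ring)
  have hpos : ∀ t ∈ Icc a b, 0 < φ t := fun t ht => by
    apply Real.cos_pos_of_mem_Ioo
    constructor <;> nlinarith [ht.1, ht.2]
  set F : ℝ → ℝ := fun t => ξ t * (deriv ξ t * φ t - ξ t * φ' t) / φ t
  have hF : ∀ t ∈ Icc a b, HasDerivAt F
      (((deriv ξ t * φ t - ξ t * φ' t) / φ t) ^ 2 + (M ^ 2 - p t) * ξ t ^ 2) t := fun t ht => by
    have hne := (hpos t ht).ne'
    refine (((h.hasDerivAt t).mul (((h.ode t).mul (hdφ t)).sub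
      ((h.hasDerivAt t).mul (hdφ' t)))).div (hdφ t) hne).congr_deriv ?_
    simp only [Pi.mul_apply, Pi.sub_apply]
    field_simp
    ring
  have hmono : MonotoneOn F (Icc a b) := by
    refine monotoneOn_of_deriv_nonneg (convex_Icc a b)
      (fun t ht => (hF t ht).continuousAt.continuousWithinAt)
      (fun t ht => (hF t (interior_subset ht)).differentiableAt.differentiableWithinAt)
      fun t ht => ?_
    rw [(hF t (interior_subset ht)).deriv]
    have := hp t
    have : 0 ≤ (M ^ 2 - p t) * ξ t ^ 2 := mul_nonneg (by linarith) (sq_nonneg _)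
    positivity
  have hF0 : ∀ t ∈ Icc a b, F t = 0 := fun t ht => by
    have h1 := hmono (left_mem_Icc.2 hab.le) ht ht.1
    have h2 := hmono ht (right_mem_Icc.2 hab.le) ht.2
    simp only [F, ha, hb, zero_mul, zero_div] at h1 h2
    exact le_antisymm h2 h1
  have hG : ∀ t ∈ Icc a b, HasDerivAt (fun t => (ξ t / φ t) ^ 2) 0 t := fun t ht => by
    have hne := (hpos t ht).ne'
    refine (((h.hasDerivAt t).div (hdφ t) hne).pow 2).congr_deriv ?_
    have h2 : 2 * F t / φ t ^ 2 = 0 := by rw [hF0 t ht]; simp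
    rw [← h2]
    simp only [F, Pi.div_apply]
    push_cast
    field_simp
  have hzero : ∀ t ∈ Icc a b, ξ t = 0 := fun t ht => by
    have := constant_of_has_deriv_right_zero
      (fun t ht => (hG t ht).continuousAt.continuousWithinAt)
      (fun t ht => (hG t ⟨ht.1, ht.2.le⟩).hasDerivWithinAt) t ht
    simpa [ha, (hpos t ht).ne'] using this
  -- In the interior of `[a, b]` also the derivative of `ξ` vanishes.
  have hmid : (a + b) / 2 ∈ Ioo a b := ⟨by linarith, by linarith⟩
  have hd0 : deriv ξ ((a + b) / 2) = 0 := by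
    have : ξ =ᶠ[nhds ((a + b) / 2)] fun _ => 0 := by
      filter_upwards [Ioo_mem_nhds hmid.1 hmid.2] with t ht using hzero t ⟨ht.1.le, ht.2.le⟩
    rw [this.deriv_eq]; simp
  exact h0 (h.eq_zero hK (hzero _ ⟨hmid.1.le, hmid.2.le⟩) hd0)

/-- **Sturm comparison**: where `m² ≤ p`, every half-open interval of length `π / m` contains a
zero. -/
theorem exists_zero_mem_Ioc (h : IsHillSolution p ξ) {m : ℝ} (hm : 0 < m)
    (hp : ∀ t, m ^ 2 ≤ p t) (a : ℝ) : ∃ t ∈ Ioc a (a + Real.pi / m), ξ t = 0 := by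
  by_contra! hne
  have hπ : a < a + Real.pi / m := by have := Real.pi_pos; linarith [div_pos this hm]
  -- It suffices to exclude that `ξ` is positive on the interval.
  have key : ∀ ζ : ℝ → ℝ, IsHillSolution p ζ →
      ¬ ∀ t ∈ Ioc a (a + Real.pi / m), 0 < ζ t := by
    intro ζ hζ hpos
    have hlin : ∀ t, HasDerivAt (fun t => m * (t - a)) m t := fun t => by
      simpa using ((hasDerivAt_id t).sub_const a).const_mul m
    have hζa : 0 ≤ ζ a := by
      have : a ∈ closure (Ioc a (a + Real.pi / m)) := by
        rw [closure_Ioc hπ.ne]; exact left_mem_Icc.2 hπ.le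
      exact closure_minimal (fun t ht => (hpos t ht).le)
        (isClosed_le continuous_const hζ.continuous) this
    have hW : ∀ t, HasDerivAt
        (fun t => deriv ζ t * Real.sin (m * (t - a)) - ζ t * (Real.cos (m * (t - a)) * m))
        ((m ^ 2 - p t) * (ζ t * Real.sin (m * (t - a)))) t := fun t =>
      (((hζ.ode t).mul (hlin t).sin).sub
        ((hζ.hasDerivAt t).mul ((hlin t).cos.mul_const m))).congr_deriv (by ring)
    have hanti : AntitoneOn (fun t => deriv ζ t * Real.sin (m * (t - a)) -
        ζ t * (Real.cos (m * (t - a)) * m)) (Icc a (a + Real.pi / m)) := by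
      refine antitoneOn_of_deriv_nonpos (convex_Icc _ _)
        (fun t _ => (hW t).continuousAt.continuousWithinAt)
        (fun t _ => (hW t).differentiableAt.differentiableWithinAt) fun t ht => ?_
      rw [interior_Icc] at ht
      rw [(hW t).deriv]
      have h1 : 0 ≤ Real.sin (m * (t - a)) := by
        apply Real.sin_nonneg_of_nonneg_of_le_pi (mul_nonneg hm.le (by linarith [ht.1]))
        have : t - a ≤ Real.pi / m := by linarith [ht.2]
        rwa [le_div_iff₀' hm] at this
      exact mul_nonpos_of_nonpos_of_nonneg (by linarith [hp t])
        (mul_nonneg (hpos t ⟨ht.1, ht.2.le⟩).le h1)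
    have := hanti (left_mem_Icc.2 hπ.le) (right_mem_Icc.2 hπ.le) hπ.le
    have e : m * (a + Real.pi / m - a) = Real.pi := by field_simp; ring
    simp only [e, sub_self, mul_zero, Real.sin_pi, Real.cos_pi, Real.sin_zero,
      Real.cos_zero] at this
    nlinarith [hpos _ (right_mem_Ioc.2 hπ)]
  have hend := hne _ (right_mem_Ioc.2 hπ)
  rcases hend.lt_or_gt with hneg | hpos
  · refine key _ (h.const_mul (-1)).1 fun t ht => ?_
    by_contra! hle
    obtain ⟨s, hs, hs0⟩ := isPreconnected_Ioc.intermediate_value (right_mem_Ioc.2 hπ) ht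
      h.continuous.continuousOn (show (0 : ℝ) ∈ Icc _ _ from ⟨hneg.le, by linarith⟩)
    exact hne s hs hs0
  · refine key _ h fun t ht => ?_
    by_contra! hle
    obtain ⟨s, hs, hs0⟩ := isPreconnected_Ioc.intermediate_value ht (right_mem_Ioc.2 hπ)
      h.continuous.continuousOn (show (0 : ℝ) ∈ Icc _ _ from ⟨hle, hpos.le⟩)
    exact hne s hs hs0

/-- If `p ≥ 0` does not vanish identically, then every solution has a zero, as a positive concave
function on the line is constant. -/
theorem exists_zero (h : IsHillSolution p ξ) (hp : ∀ t, 0 ≤ p t) {t₀ : ℝ} (ht₀ : 0 < p t₀) :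
    ∃ t, ξ t = 0 := by
  by_contra! hne
  have key : ∀ ζ : ℝ → ℝ, IsHillSolution p ζ → ¬ ∀ t, 0 < ζ t := by
    intro ζ hζ hpos
    have hanti : Antitone (deriv ζ) :=
      antitone_of_deriv_nonpos (fun t => (hζ.ode t).differentiableAt) fun t => by
        rw [(hζ.ode t).deriv]
        exact neg_nonpos.2 (mul_nonneg (hp t) (hpos t).le)
    have hd : ∀ a, deriv ζ a = 0 := by
      intro a
      by_contra hda
      -- The tangent at `a` vanishes at `t`, and the graph of `ζ` lies below it.
      set t := a - ζ a / deriv ζ a with ht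
      have hta : deriv ζ a * (t - a) = -ζ a := by rw [ht]; field_simp; ring
      rcases lt_trichotomy t a with hlt | heq | hgt
      · obtain ⟨c, hc, hc'⟩ := exists_deriv_eq_slope ζ hlt hζ.continuous.continuousOn
          hζ.differentiable.differentiableOn
        rw [eq_div_iff (by linarith)] at hc'
        nlinarith [hanti hc.2.le, hpos t]
      · rw [heq] at hta; linarith [hpos a]
      · obtain ⟨c, hc, hc'⟩ := exists_deriv_eq_slope ζ hgt hζ.continuous.continuousOn
          hζ.differentiable.differentiableOn
        rw [eq_div_iff (by linarith)] at hc'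
        nlinarith [hanti hc.1.le, hpos t]
    have h0 : deriv ζ = fun _ => 0 := funext hd
    have h1 := (hζ.ode t₀).deriv
    rw [h0, deriv_const] at h1
    nlinarith [mul_pos ht₀ (hpos t₀)]
  rcases (hne 0).lt_or_gt with hneg | hpos
  · refine key _ (h.const_mul (-1)).1 fun t => ?_
    by_contra! hle
    obtain ⟨s, hs0⟩ := mem_range_of_exists_le_of_exists_ge h.continuous ⟨0, hneg.le⟩
      ⟨t, (by linarith : (0 : ℝ) ≤ ξ t)⟩
    exact hne s hs0
  · refine key _ h fun t => ?_
    by_contra! hle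
    obtain ⟨s, hs0⟩ := mem_range_of_exists_le_of_exists_ge h.continuous ⟨t, hle⟩ ⟨0, hpos.le⟩
    exact hne s hs0

end IsHillSolution

/-! ### Comparison with the harmonic oscillator -/

/-- Duhamel bound for `f'' + k² f = g` with zero initial values. -/
theorem abs_le_of_forced_oscillator {f f' g : ℝ → ℝ} {k G a b : ℝ} (hk : 0 < k)
    (hf : ∀ t, HasDerivAt f (f' t) t) (hf' : ∀ t, HasDerivAt f' (-(k ^ 2 * f t) + g t) t)
    (ha : f a = 0) (ha' : f' a = 0) (hg : ∀ t ∈ Icc a b, |g t| ≤ G) {t : ℝ}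
    (ht : t ∈ Icc a b) : |f t| ≤ G * (b - a) / k := by
  have hlin : ∀ s, HasDerivAt (fun s => k * (t - s)) (-k) s := fun s => by
    simpa using ((hasDerivAt_id s).const_sub t).const_mul k
  have hd : ∀ s, HasDerivAt
      (fun s => f s * (k * Real.cos (k * (t - s))) + f' s * Real.sin (k * (t - s)))
      (g s * Real.sin (k * (t - s))) s := fun s =>
    (((hf s).mul ((hlin s).cos.const_mul k)).add ((hf' s).mul (hlin s).sin)).congr_deriv
      (by ring)
  have hb : ∀ s ∈ Ico a t, ‖g s * Real.sin (k * (t - s))‖ ≤ G := fun s hs => by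
    have h1 := hg s ⟨hs.1, hs.2.le.trans ht.2⟩
    rw [Real.norm_eq_abs, abs_mul]
    calc _ ≤ |g s| * 1 := by gcongr; exact Real.abs_sin_le_one _
      _ ≤ G := by linarith
  have := norm_image_sub_le_of_norm_deriv_le_segment'
    (fun s _ => (hd s).hasDerivWithinAt) hb t (right_mem_Icc.2 ht.1)
  simp only [ha, ha', sub_self, mul_zero, Real.cos_zero, Real.sin_zero, zero_mul, add_zero,
    sub_zero, mul_one, Real.norm_eq_abs, abs_mul, abs_of_pos hk] at this
  have hG : 0 ≤ G := (abs_nonneg _).trans (hg t ht)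
  rw [le_div_iff₀ hk]
  exact this.trans (mul_le_mul_of_nonneg_left (by linarith [ht.2]) hG)

namespace IsHillSolution

variable {p ξ : ℝ → ℝ}

theorem abs_sub_sin_le (h : IsHillSolution p ξ) {k ε a b : ℝ} (hk : 0 < k)
    (hp : ∀ t ∈ Icc a b, |p t - k ^ 2| ≤ ε) (hε : 2 * ε * (b - a) ≤ k)
    (ha : ξ a = 0) (ha' : deriv ξ a = k) {t : ℝ} (ht : t ∈ Icc a b) :
    |ξ t - Real.sin (k * (t - a))| ≤ 2 * ε * (b - a) / k := by
  have hab : a ≤ b := ht.1.trans ht.2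
  have hlin : ∀ s, HasDerivAt (fun s => k * (s - a)) k s := fun s => by
    simpa using ((hasDerivAt_id s).sub_const a).const_mul k
  obtain ⟨s₀, hs₀, hmax⟩ := isCompact_Icc.exists_isMaxOn (nonempty_Icc.2 hab)
    (h.continuous.abs.continuousOn (s := Icc a b))
  set N := |ξ s₀| with hN
  have hε0 : 0 ≤ ε := (abs_nonneg _).trans (hp t ht)
  have hd : ∀ s ∈ Icc a b, |ξ s - Real.sin (k * (s - a))| ≤ ε * N * (b - a) / k := by
    intro s hs
    refine abs_le_of_forced_oscillator (f := fun s => ξ s - Real.sin (k * (s - a)))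
      (f' := fun s => deriv ξ s - Real.cos (k * (s - a)) * k)
      (g := fun s => -((p s - k ^ 2) * ξ s)) hk
      (fun s => (h.hasDerivAt s).sub (hlin s).sin)
      (fun s => ((h.ode s).sub ((hlin s).cos.mul_const k)).congr_deriv (by ring))
      (by simp [ha]) (by simp [ha']) (fun r hr => ?_) hs
    rw [abs_neg, abs_mul]
    exact mul_le_mul (hp r hr) (hmax hr) (abs_nonneg _) hε0
  have hx : ε * N * (b - a) / k = (ε * (b - a) / k) * N := by ring
  have hhalf : ε * (b - a) / k ≤ 1 / 2 := by
    rw [div_le_div_iff₀ hk two_pos]; linarith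
  -- The error is at most half of the maximum `N` of `|ξ|`, hence `N ≤ 2`.
  have hN2 : N ≤ 2 := by
    have h1 := hd s₀ hs₀
    have h2 := Real.abs_sin_le_one (k * (s₀ - a))
    have h3 := abs_sub_abs_le_abs_sub (ξ s₀) (Real.sin (k * (s₀ - a)))
    rw [hx] at h1
    have : ε * (b - a) / k * N ≤ 1 / 2 * N := by gcongr
    linarith
  refine (hd t ht).trans ?_
  have : 0 ≤ b - a := by linarith
  rw [show 2 * ε * (b - a) = ε * 2 * (b - a) by ring]
  gcongr

/-- First-order perturbation of Dirichlet eigenvalues: a solution of `ξ'' + p ξ = 0` that vanishes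
at `a` and `b` forces `p - k²` to be orthogonal to `sin² (k (t - a))`, up to an error quadratic in
`p - k²`, if `sin (k (t - a))` vanishes at `b`, too. Indeed `p - k²` is exactly orthogonal to
`ξ(t) sin (k (t - a))`, and `ξ` is close to a multiple of the sine. -/
theorem abs_integral_mul_sin_sq_le (h : IsHillSolution p ξ) (hc : Continuous p) {K : ℝ}
    (hK : ∀ t, |p t| ≤ K) (h0 : ξ ≠ 0) {k ε a b : ℝ} (hk : 0 < k) (hab : a ≤ b)
    (hp : ∀ t ∈ Icc a b, |p t - k ^ 2| ≤ ε) (hε : 2 * ε * (b - a) ≤ k)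
    (ha : ξ a = 0) (hb : ξ b = 0) (hsin : Real.sin (k * (b - a)) = 0) :
    |∫ t in a..b, (p t - k ^ 2) * Real.sin (k * (t - a)) ^ 2| ≤
      2 * ε ^ 2 * (b - a) ^ 2 / k := by
  have hda := h.deriv_ne_zero hK h0 ha
  obtain ⟨hζ, hζ'⟩ := h.const_mul (k / deriv ξ a)
  set ζ : ℝ → ℝ := fun t => k / deriv ξ a * ξ t with hζdef
  have hζa : ζ a = 0 := by simp [hζdef, ha]
  have hζb : ζ b = 0 := by simp [hζdef, hb]
  have hζ'a : deriv ζ a = k := by rw [hζ']; field_simp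
  have hlin : ∀ s, HasDerivAt (fun s => k * (s - a)) k s := fun s => by
    simpa using ((hasDerivAt_id s).sub_const a).const_mul k
  have hcs : Continuous fun t => Real.sin (k * (t - a)) := by fun_prop
  have hcζ := hζ.continuous
  have hW : ∀ t, HasDerivAt
      (fun t => ζ t * (Real.cos (k * (t - a)) * k) - deriv ζ t * Real.sin (k * (t - a)))
      ((p t - k ^ 2) * (ζ t * Real.sin (k * (t - a)))) t := fun t =>
    (((hζ.hasDerivAt t).mul ((hlin t).cos.mul_const k)).sub
      ((hζ.ode t).mul (hlin t).sin)).congr_deriv (by ring)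
  have hint : ∫ t in a..b, (p t - k ^ 2) * (ζ t * Real.sin (k * (t - a))) = 0 := by
    rw [intervalIntegral.integral_eq_sub_of_hasDerivAt (fun t _ => hW t)
      (Continuous.intervalIntegrable (by fun_prop) _ _)]
    simp [hζa, hζb, hsin]
  have hsplit : ∫ t in a..b, (p t - k ^ 2) * Real.sin (k * (t - a)) ^ 2 =
      ∫ t in a..b, -((p t - k ^ 2) * ((ζ t - Real.sin (k * (t - a))) *
        Real.sin (k * (t - a)))) := by
    rw [← add_zero (∫ t in a..b, -((p t - k ^ 2) * ((ζ t - Real.sin (k * (t - a))) *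
        Real.sin (k * (t - a))))), ← hint, ← intervalIntegral.integral_add
      (Continuous.intervalIntegrable (by fun_prop) _ _)
      (Continuous.intervalIntegrable (by fun_prop) _ _)]
    congr 1; funext t; ring
  have hε0 : 0 ≤ ε := (abs_nonneg _).trans (hp a (left_mem_Icc.2 hab))
  rw [hsplit, ← Real.norm_eq_abs]
  refine (intervalIntegral.norm_integral_le_of_norm_le_const
    (C := ε * (2 * ε * (b - a) / k * 1)) fun t ht => ?_).trans (le_of_eq ?_)
  · rw [uIoc_of_le hab] at ht
    have ht' : t ∈ Icc a b := ⟨ht.1.le, ht.2⟩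
    rw [norm_neg, Real.norm_eq_abs, abs_mul, abs_mul]
    have := hζ.abs_sub_sin_le hk hp hε hζa hζ'a ht'
    have hba : 0 ≤ b - a := by linarith
    gcongr
    · exact hp t ht'
    · exact Real.abs_sin_le_one _
  · rw [abs_of_nonneg (by linarith)]; field_simp

end IsHillSolution

/-! ### Averages of trigonometric functions -/

theorem integral_cos_affine_eq_zero {α T : ℝ} (hα : α ≠ 0) {n : ℕ}
    (hT : α * T = n * (2 * Real.pi)) (β a : ℝ) :
    ∫ t in a..a + T, Real.cos (α * t + β) = 0 := by
  have hd : ∀ t, HasDerivAt (fun t => Real.sin (α * t + β) / α) (Real.cos (α * t + β)) t :=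
    fun t => by
      have := ((((hasDerivAt_id t).const_mul α).add_const β).sin).div_const α
      simpa [hα] using this
  rw [intervalIntegral.integral_eq_sub_of_hasDerivAt (fun t _ => hd t)
    (Continuous.intervalIntegrable (by fun_prop) _ _),
    show α * (a + T) + β = α * a + β + n * (2 * Real.pi) by rw [← hT]; ring,
    Real.sin_add_nat_mul_two_pi, sub_self]

theorem integral_sin_sq_eq {ω T : ℝ} (hω : 0 < ω) (hT : ω * T = Real.pi) {ℓ : ℕ}
    (hℓ : 1 ≤ ℓ) (a : ℝ) :
    ∫ t in a..a + T, Real.sin (ℓ * ω * (t - a)) ^ 2 = T / 2 := by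
  have hℓ0 : (0 : ℝ) < ℓ := by exact_mod_cast hℓ
  have e : ∀ t, Real.sin (ℓ * ω * (t - a)) ^ 2 =
      1 / 2 - 1 / 2 * Real.cos (2 * ℓ * ω * t + -(2 * ℓ * ω * a)) := fun t => by
    rw [Real.sin_sq_eq_half_sub, show 2 * ℓ * ω * t + -(2 * ℓ * ω * a) = 2 * (ℓ * ω * (t - a)) by
      ring]
    ring
  simp_rw [e]
  rw [intervalIntegral.integral_sub (by simp) (Continuous.intervalIntegrable (by fun_prop) _ _),
    intervalIntegral.integral_const_mul,
    integral_cos_affine_eq_zero (n := ℓ) (by positivity) (by linear_combination 2 * (ℓ : ℝ) * hT)]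
  simp
  ring

theorem integral_cos_sq_mul_sin_sq_eq {ω T : ℝ} (hω : 0 < ω) (hT : ω * T = Real.pi) {ℓ : ℕ}
    (hℓ : 1 ≤ ℓ) (a : ℝ) :
    ∫ t in a..a + T, Real.cos (ω * t) ^ 2 * Real.sin (ℓ * ω * (t - a)) ^ 2 =
      T / 4 - 1 / 8 * ∫ t in a..a + T, Real.cos (2 * (ℓ - 1) * ω * t + -(2 * ℓ * ω * a)) := by
  have hℓ0 : (0 : ℝ) < ℓ := by exact_mod_cast hℓ
  have e : ∀ t, Real.cos (ω * t) ^ 2 * Real.sin (ℓ * ω * (t - a)) ^ 2 =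
      1 / 4 + 1 / 4 * Real.cos (2 * ω * t + 0)
        - 1 / 4 * Real.cos (2 * ℓ * ω * t + -(2 * ℓ * ω * a))
        - 1 / 8 * Real.cos (2 * (ℓ + 1) * ω * t + -(2 * ℓ * ω * a))
        - 1 / 8 * Real.cos (2 * (ℓ - 1) * ω * t + -(2 * ℓ * ω * a)) := fun t => by
    rw [Real.sin_sq_eq_half_sub, Real.cos_sq,
      show 2 * (ℓ * ω * (t - a)) = 2 * ℓ * ω * t + -(2 * ℓ * ω * a) by ring,
      show 2 * (ℓ + 1) * ω * t + -(2 * ℓ * ω * a) =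
        (2 * ℓ * ω * t + -(2 * ℓ * ω * a)) + 2 * (ω * t) by ring,
      show 2 * (ℓ - 1) * ω * t + -(2 * ℓ * ω * a) =
        (2 * ℓ * ω * t + -(2 * ℓ * ω * a)) - 2 * (ω * t) by ring,
      Real.cos_add (2 * ℓ * ω * t + -(2 * ℓ * ω * a)),
      Real.cos_sub (2 * ℓ * ω * t + -(2 * ℓ * ω * a)), add_zero, mul_assoc 2 ω t]
    ring
  have hc : ∀ c α β : ℝ, IntervalIntegrable (fun t => c * Real.cos (α * t + β))
      MeasureTheory.volume a (a + T) := fun c α β =>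
    Continuous.intervalIntegrable (by fun_prop) _ _
  have h1 : IntervalIntegrable (fun _ : ℝ => (1 / 4 : ℝ)) MeasureTheory.volume a (a + T) := by simp
  simp_rw [e]
  rw [intervalIntegral.integral_sub (((h1.add (hc _ _ _)).sub (hc _ _ _)).sub (hc _ _ _))
      (hc _ _ _),
    intervalIntegral.integral_sub ((h1.add (hc _ _ _)).sub (hc _ _ _)) (hc _ _ _),
    intervalIntegral.integral_sub (h1.add (hc _ _ _)) (hc _ _ _),
    intervalIntegral.integral_add h1 (hc _ _ _)]
  simp only [intervalIntegral.integral_const_mul]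
  rw [integral_cos_affine_eq_zero (n := 1) (by positivity)
      (by push_cast; linear_combination 2 * hT),
    integral_cos_affine_eq_zero (n := ℓ) (by positivity)
      (by linear_combination 2 * (ℓ : ℝ) * hT),
    integral_cos_affine_eq_zero (n := ℓ + 1) (by positivity)
      (by push_cast; linear_combination 2 * ((ℓ : ℝ) + 1) * hT)]
  simp
  ring

/-- The second harmonic `cos² (ω t)` does not resonate with `sin² (ℓ ω (t - a))` for `ℓ ≥ 2`: the
average of the product is the product of the averages. -/
theorem integral_cos_sq_mul_sin_sq {ω T : ℝ} (hω : 0 < ω) (hT : ω * T = Real.pi) {ℓ : ℕ}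
    (hℓ : 2 ≤ ℓ) (a : ℝ) :
    ∫ t in a..a + T, Real.cos (ω * t) ^ 2 * Real.sin (ℓ * ω * (t - a)) ^ 2 = T / 4 := by
  have hℓ0 : (0 : ℝ) < ℓ - 1 := by
    have : (2 : ℝ) ≤ ℓ := by exact_mod_cast hℓ
    linarith
  rw [integral_cos_sq_mul_sin_sq_eq hω hT (by omega),
    integral_cos_affine_eq_zero (n := ℓ - 1) (by positivity) (by
      rw [Nat.cast_sub (by omega), Nat.cast_one]; linear_combination 2 * ((ℓ : ℝ) - 1) * hT)]
  ring

theorem integral_cos_sq_mul_sin_sq_self {ω T : ℝ} (hω : 0 < ω) (hT : ω * T = Real.pi) :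
    ∫ t in (0 : ℝ)..0 + T, Real.cos (ω * t) ^ 2 * Real.sin ((1 : ℕ) * ω * (t - 0)) ^ 2 =
      T / 8 := by
  rw [integral_cos_sq_mul_sin_sq_eq hω hT le_rfl]
  simp
  ring

/-! ### The Duffing oscillator -/

namespace IsDuffingSolution

variable {δ : ℝ} {y : ℝ → ℝ}

theorem continuous (h : IsDuffingSolution δ y) : Continuous y := h.differentiable.continuous

theorem hasDerivAt (h : IsDuffingSolution δ y) (t : ℝ) : HasDerivAt y (deriv y t) t :=
  (h.differentiable t).hasDerivAt

theorem energy (h : IsDuffingSolution δ y) (t : ℝ) :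
    deriv y t ^ 2 + y t ^ 2 + y t ^ 4 / 2 = δ ^ 2 + δ ^ 4 / 2 := by
  have hd : ∀ t, HasDerivAt (fun t => deriv y t ^ 2 + y t ^ 2 + y t ^ 4 / 2) 0 t := fun t =>
    ((((h.ode t).pow 2).add ((h.hasDerivAt t).pow 2)).add
      (((h.hasDerivAt t).pow 4).div_const 2)).congr_deriv (by push_cast; ring)
  have := is_const_of_deriv_eq_zero (fun t => (hd t).differentiableAt) (fun t => (hd t).deriv) t 0
  simpa [h.init, h.init_deriv] using this

theorem sq_le (h : IsDuffingSolution δ y) (t : ℝ) : y t ^ 2 ≤ δ ^ 2 := by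
  have := h.energy t
  nlinarith [sq_nonneg (deriv y t), sq_nonneg (y t), sq_nonneg δ]

theorem abs_apply_le (h : IsDuffingSolution δ y) (hδ : 0 ≤ δ) (t : ℝ) : |y t| ≤ δ :=
  abs_le_of_sq_le_sq (h.sq_le t) hδ

/-- The velocity solves the variational equation, which is a Hill equation. -/
theorem velocity (h : IsDuffingSolution δ y) :
    IsHillSolution (fun t => 1 + 3 * y t ^ 2) (deriv y) ∧
      deriv (deriv y) = fun t => -(y t + y t ^ 3) :=
  IsHillSolution.of_hasDerivAt h.ode fun t =>
    ((h.hasDerivAt t).add ((h.hasDerivAt t).pow 3)).neg.congr_deriv (by push_cast; ring)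

theorem abs_one_add_three_mul_sq_le (h : IsDuffingSolution δ y) (t : ℝ) :
    |1 + 3 * y t ^ 2| ≤ 1 + 3 * δ ^ 2 := by
  rw [abs_of_nonneg (by positivity)]
  linarith [h.sq_le t]

theorem abs_add_sq_le (h : IsDuffingSolution δ y) (γ t : ℝ) :
    |γ + y t ^ 2| ≤ |γ| + δ ^ 2 := by
  refine (abs_add_le _ _).trans ?_
  rw [abs_of_nonneg (sq_nonneg (y t))]
  linarith [h.sq_le t]

theorem velocity_ne_zero (h : IsDuffingSolution δ y) (hδ : 0 < δ) : deriv y ≠ 0 := fun h0 => by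
  have h1 := congrFun h.velocity.2 0
  rw [h0, h.init] at h1
  have : deriv (0 : ℝ → ℝ) 0 = 0 := by simp
  rw [this] at h1
  have := pow_pos hδ 3
  linarith

theorem velocity_eq_zero_of_periodic (h : IsDuffingSolution δ y) {T : ℝ}
    (hT : Function.Periodic (fun t => y t ^ 2) T) : deriv y T = 0 := by
  have h1 : y T ^ 2 = δ ^ 2 := by simpa [h.init] using hT 0
  have h2 := h.energy T
  have h3 : y T ^ 4 = δ ^ 4 := by rw [show 4 = 2 * 2 from rfl, pow_mul, pow_mul, h1]
  rw [h1, h3] at h2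
  exact pow_eq_zero_iff two_ne_zero |>.1 (by linarith : deriv y T ^ 2 = 0)

/-- When the velocity vanishes, the position is `± δ`, and the motion repeats itself up to this
sign. -/
theorem periodic_of_velocity_eq_zero (h : IsDuffingSolution δ y) {T : ℝ}
    (hT : deriv y T = 0) : Function.Periodic (fun t => y t ^ 2) T := by
  have hy : y T ^ 2 = δ ^ 2 := by
    have h2 := h.energy T
    rw [hT] at h2
    have h3 : (y T ^ 2 - δ ^ 2) * (1 + (y T ^ 2 + δ ^ 2) / 2) = 0 := by linear_combination h2
    have h4 : 1 + (y T ^ 2 + δ ^ 2) / 2 ≠ 0 := by positivity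
    exact sub_eq_zero.1 ((mul_eq_zero.1 h3).resolve_right h4)
  obtain ⟨σ, hσ, hyT⟩ : ∃ σ : ℝ, σ ^ 2 = 1 ∧ y T = σ * δ := by
    rcases sq_eq_sq_iff_eq_or_eq_neg.1 hy with e | e
    · exact ⟨1, by norm_num, by simpa using e⟩
    · exact ⟨-1, by norm_num, by simpa using e⟩
  have hz := IsHillSolution.of_hasDerivAt (ξ := fun t => y (t + T) - σ * y t)
    (p := fun t => 1 + y (t + T) ^ 2 + σ * y (t + T) * y t + y t ^ 2)
    (fun t => ((h.hasDerivAt (t + T)).comp_add_const t T).sub ((h.hasDerivAt t).const_mul σ))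
    (fun t => (((h.ode (t + T)).comp_add_const t T).sub ((h.ode t).const_mul σ)).congr_deriv
      (by linear_combination -(y (t + T) * y t ^ 2) * hσ))
  have hbd : ∀ t, |1 + y (t + T) ^ 2 + σ * y (t + T) * y t + y t ^ 2| ≤ 1 + 3 * δ ^ 2 := by
    intro t
    have h1 := h.sq_le t
    have h2 := h.sq_le (t + T)
    have h3 : (σ * y t) ^ 2 = y t ^ 2 := by rw [mul_pow, hσ, one_mul]
    rw [abs_le']
    constructor
    · nlinarith [sq_nonneg (y (t + T) - σ * y t)]
    · nlinarith [sq_nonneg (y (t + T) + σ * y t)]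
  have hzero := hz.1.eq_zero hbd (a := 0) (by simp [h.init, hyT])
    (by rw [hz.2]; simp [h.init_deriv, hT])
  intro t
  have h1 : y (t + T) - σ * y t = 0 := congrFun hzero t
  have h2 : y (t + T) = σ * y t := by linarith
  simp only [h2, mul_pow, hσ, one_mul]

theorem exists_velocity_eq_zero (h : IsDuffingSolution δ y) :
    ∃ T, 0 < T ∧ T ≤ Real.pi ∧ deriv y T = 0 := by
  obtain ⟨T, ⟨h0, h1⟩, hT⟩ := h.velocity.1.exists_zero_mem_Ioc one_pos
    (fun t => by nlinarith [sq_nonneg (y t)]) 0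
  exact ⟨T, h0, by simpa using h1, hT⟩

theorem smallest_period_bound (h : IsDuffingSolution δ y) {γ T : ℝ}
    (hT : IsSmallestPeriod (fun t => γ + y t ^ 2) T) :
    0 < T ∧ T ≤ Real.pi ∧ deriv y T = 0 := by
  obtain ⟨⟨h0, hper⟩, hmin⟩ := hT
  obtain ⟨S, hS0, hS1, hS⟩ := h.exists_velocity_eq_zero
  refine ⟨h0, (hmin ⟨hS0, fun t => ?_⟩).trans hS1,
    h.velocity_eq_zero_of_periodic fun t => add_left_cancel (hper t)⟩
  exact congrArg (γ + ·) (h.periodic_of_velocity_eq_zero hS t)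

/-- The bounds `1 ≤ ω² ≤ 1 + 3 δ²` on the frequency `ω = π / T`. -/
theorem frequency_bound (h : IsDuffingSolution δ y) (hδ : 0 < δ) {ω T : ℝ} (hT0 : 0 < T)
    (hT1 : T ≤ Real.pi) (hT : deriv y T = 0) (hω : ω * T = Real.pi) :
    1 ≤ ω ∧ 1 ≤ ω ^ 2 ∧ ω ^ 2 ≤ 1 + 3 * δ ^ 2 := by
  have h1 : 1 ≤ ω := by
    by_contra! hlt
    nlinarith
  have h2 := h.velocity.1.pi_le_mul_sub h.abs_one_add_three_mul_sq_le (h.velocity_ne_zero hδ)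
    (M := √(1 + 3 * δ ^ 2)) (Real.sqrt_nonneg _)
    (fun t => by rw [Real.sq_sqrt (by positivity)]; linarith [h.sq_le t]) hT0 h.init_deriv hT
  rw [sub_zero, ← hω] at h2
  exact ⟨h1, by nlinarith, (Real.le_sqrt' (by linarith)).1 (le_of_mul_le_mul_right h2 hT0)⟩

theorem abs_sq_sub_le (h : IsDuffingSolution δ y) (hδ : 0 < δ) {ω T : ℝ} (hT0 : 0 < T)
    (hT1 : T ≤ Real.pi) (hT : deriv y T = 0) (hω : ω * T = Real.pi) (t : ℝ) :
    |y t ^ 2 - δ ^ 2 * Real.cos (ω * t) ^ 2| ≤ 8 * Real.pi * δ ^ 4 := by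
  obtain ⟨h1, h2, h3⟩ := h.frequency_bound hδ hT0 hT1 hT hω
  -- Both sides are `T`-periodic, so that `t ∈ [0, T]` without loss of generality.
  have hper : Function.Periodic (fun t => y t ^ 2 - δ ^ 2 * Real.cos (ω * t) ^ 2) T := fun t => by
    have e := h.periodic_of_velocity_eq_zero hT t
    simp only at e ⊢
    rw [e, mul_add, hω, Real.cos_add_pi, neg_sq]
  obtain ⟨s, hs, hst⟩ := hper.exists_mem_Ico₀ hT0 t
  rw [hst]
  have hlin : ∀ t, HasDerivAt (fun t => ω * t) ω t := fun t => by
    simpa using (hasDerivAt_id t).const_mul ω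
  have hf := abs_le_of_forced_oscillator (f := fun t => y t - δ * Real.cos (ω * t))
    (f' := fun t => deriv y t - δ * (-Real.sin (ω * t) * ω))
    (g := fun t => (ω ^ 2 - 1) * y t - y t ^ 3) (k := ω) (G := 4 * δ ^ 3) (a := 0) (b := T)
    (by linarith) (fun t => (h.hasDerivAt t).sub ((hlin t).cos.const_mul δ))
    (fun t => ((h.ode t).sub (((hlin t).sin.neg.mul_const ω).const_mul δ)).congr_deriv (by ring))
    (by simp [h.init]) (by simp [h.init_deriv]) (fun t _ => by
      have hy := h.abs_apply_le hδ.le t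
      calc |(ω ^ 2 - 1) * y t - y t ^ 3| ≤ |(ω ^ 2 - 1) * y t| + |y t ^ 3| := abs_sub _ _
        _ = (ω ^ 2 - 1) * |y t| + |y t| ^ 3 := by
          rw [abs_mul, abs_pow, abs_of_nonneg (by linarith : 0 ≤ ω ^ 2 - 1)]
        _ ≤ (3 * δ ^ 2) * δ + δ ^ 3 := by gcongr; linarith
        _ = 4 * δ ^ 3 := by ring) ⟨hs.1, hs.2.le⟩
  have hf' : |y s - δ * Real.cos (ω * s)| ≤ 4 * Real.pi * δ ^ 3 := by
    refine hf.trans ?_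
    rw [div_le_iff₀ (by linarith), sub_zero]
    have h4 : T ≤ Real.pi * ω := by nlinarith
    have := mul_le_mul_of_nonneg_left h4 (by positivity : 0 ≤ 4 * δ ^ 3)
    linarith
  have hsum : |y s + δ * Real.cos (ω * s)| ≤ 2 * δ := by
    refine (abs_add_le _ _).trans ?_
    rw [abs_mul, abs_of_pos hδ]
    nlinarith [h.abs_apply_le hδ.le s, Real.abs_cos_le_one (ω * s)]
  calc |y s ^ 2 - δ ^ 2 * Real.cos (ω * s) ^ 2|
      = |y s - δ * Real.cos (ω * s)| * |y s + δ * Real.cos (ω * s)| := by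
        rw [← abs_mul]; congr 1; ring
    _ ≤ 4 * Real.pi * δ ^ 3 * (2 * δ) := by gcongr
    _ = 8 * Real.pi * δ ^ 4 := by ring

/-- In the integrals that give the Dirichlet eigenvalues, `y²` may be replaced by
`δ² cos² (ω t)`. -/
theorem abs_integral_sq_mul_sin_sq_sub_le (h : IsDuffingSolution δ y) (hδ : 0 < δ) {ω T : ℝ}
    (hT0 : 0 < T) (hT1 : T ≤ Real.pi) (hT : deriv y T = 0) (hω : ω * T = Real.pi) (ℓ : ℕ)
    (a : ℝ) :
    |(∫ t in a..a + T, y t ^ 2 * Real.sin (ℓ * ω * (t - a)) ^ 2) -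
      δ ^ 2 * ∫ t in a..a + T, Real.cos (ω * t) ^ 2 * Real.sin (ℓ * ω * (t - a)) ^ 2| ≤
      8 * Real.pi * δ ^ 4 * T := by
  have hy := h.continuous
  rw [← intervalIntegral.integral_const_mul, ← intervalIntegral.integral_sub
    (Continuous.intervalIntegrable (by fun_prop) _ _)
    (Continuous.intervalIntegrable (by fun_prop) _ _), ← Real.norm_eq_abs]
  refine (intervalIntegral.norm_integral_le_of_norm_le_const
    (C := 8 * Real.pi * δ ^ 4) fun t _ => ?_).trans_eq ?_
  · rw [← mul_assoc, ← sub_mul, Real.norm_eq_abs, abs_mul, abs_of_nonneg (sq_nonneg (Real.sin _))]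
    calc _ ≤ 8 * Real.pi * δ ^ 4 * 1 := by
          gcongr
          · exact h.abs_sq_sub_le hδ hT0 hT1 hT hω t
          · exact Real.sin_sq_le_one _
      _ = _ := mul_one _
  · rw [add_sub_cancel_left, abs_of_pos hT0]

/-- The amplitude-frequency relation of the Duffing oscillator. The velocity is a Dirichlet
eigenfunction on `[0, T]` of the variational equation, whose lowest eigenvalue is computed to first
order in `δ²`. -/
theorem abs_frequency_sq_sub_le (h : IsDuffingSolution δ y) (hδ : 0 < δ) (hδ1 : δ ≤ 1 / 5)
    {ω T : ℝ} (hT0 : 0 < T) (hT1 : T ≤ Real.pi) (hT : deriv y T = 0) (hω : ω * T = Real.pi) :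
    |ω ^ 2 - 1 - 3 / 4 * δ ^ 2| ≤ 84 * Real.pi * δ ^ 4 := by
  obtain ⟨h1, h2, h3⟩ := h.frequency_bound hδ hT0 hT1 hT hω
  have hω0 : 0 < ω := by linarith
  have hy := h.continuous
  have hmain := h.velocity.1.abs_integral_mul_sin_sq_le (by fun_prop)
    h.abs_one_add_three_mul_sq_le (h.velocity_ne_zero hδ) (k := (1 : ℕ) * ω) (ε := 3 * δ ^ 2)
    (a := 0) (b := 0 + T) (by push_cast; linarith) (by linarith) (fun t _ => by
      have := h.sq_le t
      rw [abs_le']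
      push_cast
      constructor <;> nlinarith [sq_nonneg (y t)])
    (by push_cast; nlinarith [Real.pi_lt_d2]) h.init_deriv (by simpa using hT)
    (by rw [zero_add, sub_zero, Nat.cast_one, one_mul, hω, Real.sin_pi])
  have hI := h.abs_integral_sq_mul_sin_sq_sub_le hδ hT0 hT1 hT hω 1 0
  rw [integral_cos_sq_mul_sin_sq_self hω0 hω] at hI
  have hsplit : ∫ t in (0 : ℝ)..0 + T,
      (1 + 3 * y t ^ 2 - ((1 : ℕ) * ω) ^ 2) * Real.sin ((1 : ℕ) * ω * (t - 0)) ^ 2 =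
      (1 - ω ^ 2) * (T / 2) +
        3 * ∫ t in (0 : ℝ)..0 + T, y t ^ 2 * Real.sin ((1 : ℕ) * ω * (t - 0)) ^ 2 := by
    rw [← integral_sin_sq_eq hω0 hω le_rfl 0, ← intervalIntegral.integral_const_mul,
      ← intervalIntegral.integral_const_mul, ← intervalIntegral.integral_add
      (Continuous.intervalIntegrable (by fun_prop) _ _)
      (Continuous.intervalIntegrable (by fun_prop) _ _)]
    congr 1; funext t; push_cast; ring
  rw [hsplit] at hmain
  have hb : 2 * (3 * δ ^ 2) ^ 2 * (0 + T - 0) ^ 2 / ((1 : ℕ) * ω) ≤ 18 * Real.pi * δ ^ 4 * T := by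
    rw [div_le_iff₀ (by push_cast; linarith)]
    have h4 : T ≤ Real.pi * ω := by nlinarith
    have := mul_le_mul_of_nonneg_left h4 (by positivity : 0 ≤ 18 * δ ^ 4 * T)
    push_cast
    linarith
  have h5 := abs_le.1 (hmain.trans hb)
  have h6 := abs_le.1 hI
  rw [abs_le]
  constructor <;> refine le_of_mul_le_mul_right ?_ (half_pos hT0) <;> linarith

/-- First-order expansion of the `ℓ`-th Dirichlet eigenvalue of the Hill equation on a period
`[a, a + T]`, which for `ℓ ≥ 2` does not depend on `a`. -/
theorem abs_dirichlet_eigenvalue_sub_le (h : IsDuffingSolution δ y) (hδ : 0 < δ)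
    (hδ1 : δ ≤ 1 / 5) {ω T : ℝ} (hT0 : 0 < T) (hT1 : T ≤ Real.pi) (hT : deriv y T = 0)
    (hω : ω * T = Real.pi) {ℓ : ℕ} (hℓ : 2 ≤ ℓ) {γ B : ℝ}
    (hγ : |γ - (ℓ * ω) ^ 2| ≤ B * δ ^ 2) (hsmall : (B + 1) * δ ^ 2 * Real.pi ≤ 1) {ξ : ℝ → ℝ}
    (hξ : IsHillSolution (fun t => γ + y t ^ 2) ξ) (h0 : ξ ≠ 0) {a : ℝ} (ha : ξ a = 0)
    (hb : ξ (a + T) = 0) :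
    |γ - ℓ ^ 2 - (3 * ℓ ^ 2 / 4 - 1 / 2) * δ ^ 2| ≤
      (4 * Real.pi * (B + 1) ^ 2 + 16 * Real.pi + 84 * Real.pi * ℓ ^ 2) * δ ^ 4 := by
  obtain ⟨h1, h2, h3⟩ := h.frequency_bound hδ hT0 hT1 hT hω
  have hω0 : 0 < ω := by linarith
  have hℓ2 : (2 : ℝ) ≤ ℓ := by exact_mod_cast hℓ
  have hk2 : 2 ≤ ℓ * ω := by nlinarith
  have hB : 0 ≤ (B + 1) * δ ^ 2 := by nlinarith [(abs_nonneg _).trans hγ, sq_nonneg δ]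
  have hy := h.continuous
  have hmain := hξ.abs_integral_mul_sin_sq_le (by fun_prop)
    (h.abs_add_sq_le γ) h0 (k := ℓ * ω) (ε := (B + 1) * δ ^ 2)
    (a := a) (b := a + T) (by linarith) (by linarith) (fun t _ => by
      have := h.sq_le t
      have h4 := abs_le.1 hγ
      rw [abs_le']
      constructor <;> nlinarith [sq_nonneg (y t)])
    (by nlinarith) ha hb
    (by rw [add_sub_cancel_left, mul_assoc, hω, Real.sin_nat_mul_pi])
  have hI := h.abs_integral_sq_mul_sin_sq_sub_le hδ hT0 hT1 hT hω ℓ a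
  rw [integral_cos_sq_mul_sin_sq hω0 hω hℓ] at hI
  have hsplit : ∫ t in a..a + T,
      (γ + y t ^ 2 - (ℓ * ω) ^ 2) * Real.sin (ℓ * ω * (t - a)) ^ 2 =
      (γ - (ℓ * ω) ^ 2) * (T / 2) +
        ∫ t in a..a + T, y t ^ 2 * Real.sin (ℓ * ω * (t - a)) ^ 2 := by
    rw [← integral_sin_sq_eq hω0 hω (by omega : 1 ≤ ℓ) a, ← intervalIntegral.integral_const_mul,
      ← intervalIntegral.integral_add
      (Continuous.intervalIntegrable (by fun_prop) _ _)
      (Continuous.intervalIntegrable (by fun_prop) _ _)]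
    congr 1; funext t; ring
  rw [hsplit] at hmain
  have hb : 2 * ((B + 1) * δ ^ 2) ^ 2 * (a + T - a) ^ 2 / (ℓ * ω) ≤
      2 * Real.pi * (B + 1) ^ 2 * δ ^ 4 * T := by
    rw [div_le_iff₀ (by linarith)]
    have h4 : T ≤ Real.pi * (ℓ * ω) := by nlinarith [Real.pi_pos]
    have := mul_le_mul_of_nonneg_left h4 (by positivity : 0 ≤ 2 * (B + 1) ^ 2 * δ ^ 4 * T)
    rw [add_sub_cancel_left]
    linarith
  have h5 := abs_le.1 (hmain.trans hb)
  have h6 := abs_le.1 hI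
  have h7 : |γ - (ℓ * ω) ^ 2 + δ ^ 2 / 2| ≤
      (4 * Real.pi * (B + 1) ^ 2 + 16 * Real.pi) * δ ^ 4 := by
    rw [abs_le]
    constructor <;> refine le_of_mul_le_mul_right ?_ (half_pos hT0) <;> linarith
  have h8 := mul_le_mul_of_nonneg_left (h.abs_frequency_sq_sub_le hδ hδ1 hT0 hT1 hT hω)
    (sq_nonneg (ℓ : ℝ))
  rw [← abs_of_nonneg (sq_nonneg (ℓ : ℝ)), ← abs_mul, abs_of_nonneg (sq_nonneg (ℓ : ℝ))] at h8
  calc |γ - ℓ ^ 2 - (3 * ℓ ^ 2 / 4 - 1 / 2) * δ ^ 2|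
      = |(γ - (ℓ * ω) ^ 2 + δ ^ 2 / 2) + ℓ ^ 2 * (ω ^ 2 - 1 - 3 / 4 * δ ^ 2)| := by
        congr 1; ring
    _ ≤ _ := abs_add_le _ _
    _ ≤ _ := by linarith

end IsDuffingSolution

/-! ### Stability in the absence of real Floquet multipliers -/

namespace IsHillSolution

variable {p : ℝ → ℝ}

/-- The space of solutions of the Hill equation. -/
def solutionSpace (p : ℝ → ℝ) : Submodule ℝ (ℝ → ℝ) where
  carrier := {ξ | IsHillSolution p ξ}
  add_mem' h h' := (h.add h').1
  zero_mem' := (of_hasDerivAt (η := fun _ => 0) (fun t => hasDerivAt_const t (0 : ℝ))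
    fun t => (hasDerivAt_const t (0 : ℝ)).congr_deriv (by simp)).1
  smul_mem' c _ h := (h.const_mul c).1

/-- The initial values `(ξ(0), ξ'(0))` as a linear function of the solution `ξ`. -/
noncomputable def initialValues (p : ℝ → ℝ) : solutionSpace p →ₗ[ℝ] ℝ × ℝ where
  toFun ξ := (ξ.1 0, deriv ξ.1 0)
  map_add' ξ η := Prod.ext rfl (congrFun (ξ.2.add η.2).2 0)
  map_smul' c ξ := Prod.ext rfl (congrFun (ξ.2.const_mul c).2 0)

/-- The translation by a period acting on solutions. -/
def translation {T : ℝ} (hT : Function.Periodic p T) :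
    solutionSpace p →ₗ[ℝ] solutionSpace p where
  toFun ξ := ⟨fun t => ξ.1 (t + T), (ξ.2.shift hT).1⟩
  map_add' _ _ := rfl
  map_smul' _ _ := rfl

theorem initialValues_injective {K : ℝ} (hK : ∀ t, |p t| ≤ K) :
    Function.Injective (initialValues p) := by
  rw [← LinearMap.ker_eq_bot, LinearMap.ker_eq_bot']
  intro ξ hξ
  exact Subtype.ext (ξ.2.eq_zero hK (congrArg Prod.fst hξ) (congrArg Prod.snd hξ))

/-- A homogeneous quadratic function without nontrivial zeros on a finite-dimensional space is
comparable to the square of the norm. -/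
theorem exists_le_mul_sq_norm {E : Type*} [NormedAddCommGroup E] [NormedSpace ℝ E]
    [FiniteDimensional ℝ E] {Q : E → ℝ} (hQ : Continuous Q)
    (hhom : ∀ (c : ℝ) x, Q (c • x) = c ^ 2 * Q x) (hne : ∀ x, x ≠ 0 → Q x ≠ 0) :
    ∃ A > 0, ∀ x x', |Q x| = |Q x'| → ‖x‖ ^ 2 ≤ A * ‖x'‖ ^ 2 := by
  have : ProperSpace E := FiniteDimensional.proper_real E
  rcases (Metric.sphere (0 : E) 1).eq_empty_or_nonempty with hempty | hS
  · refine ⟨1, one_pos, fun x x' _ => ?_⟩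
    have : x = 0 := by
      by_contra hx
      have : (‖x‖⁻¹ • x) ∈ Metric.sphere (0 : E) 1 := by simp [norm_smul, hx]
      simp [hempty] at this
    rw [this]; simp
  obtain ⟨u, hu, hmin⟩ := (isCompact_sphere (0 : E) 1).exists_isMinOn hS hQ.abs.continuousOn
  obtain ⟨v, hv, hmax⟩ := (isCompact_sphere (0 : E) 1).exists_isMaxOn hS hQ.abs.continuousOn
  have hpos : ∀ w ∈ Metric.sphere (0 : E) 1, 0 < |Q w| := fun w hw =>
    abs_pos.2 (hne w (ne_zero_of_mem_unit_sphere ⟨w, hw⟩))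
  have hQx : ∀ x, |Q u| * ‖x‖ ^ 2 ≤ |Q x| ∧ |Q x| ≤ |Q v| * ‖x‖ ^ 2 := by
    intro x
    by_cases hx : x = 0
    · have h0 : Q 0 = 0 := by simpa using hhom 0 0
      simp [hx, h0]
    have hs : (‖x‖⁻¹ • x) ∈ Metric.sphere (0 : E) 1 := by simp [norm_smul, hx]
    have e : |Q x| = |Q (‖x‖⁻¹ • x)| * ‖x‖ ^ 2 := by
      rw [hhom, abs_mul, abs_of_nonneg (sq_nonneg ‖x‖⁻¹)]
      have : ‖x‖ ≠ 0 := norm_ne_zero_iff.2 hx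
      field_simp
    rw [e]
    exact ⟨mul_le_mul_of_nonneg_right (hmin hs) (sq_nonneg _),
      mul_le_mul_of_nonneg_right (hmax hs) (sq_nonneg _)⟩
  refine ⟨|Q v| / |Q u|, div_pos (hpos v hv) (hpos u hu), fun x x' hxx' => ?_⟩
  rw [div_mul_eq_mul_div, le_div_iff₀' (hpos u hu)]
  exact (hQx x).1.trans (hxx' ▸ (hQx x').2)

/-- **Stability criterion**: a Hill equation without nontrivial Floquet solution for a real
multiplier is stable. The Wronskian of a solution and its translate by a period is a quadratic form
on the space of solutions, invariant under the translation, and it vanishes only on Floquet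
solutions. Hence it is definite, and bounds the solution at all multiples of the period. -/
theorem trivialSolutionStable {K T : ℝ} (hK : ∀ t, |p t| ≤ K) (hT0 : 0 < T)
    (hT : Function.Periodic p T)
    (hno : ∀ (c : ℝ) (ξ : ℝ → ℝ), IsHillSolution p ξ → ξ ≠ 0 → ¬ ∀ t, ξ (t + T) = c * ξ t) :
    TrivialSolutionStable p := by
  have hinj := initialValues_injective hK
  set e := LinearEquiv.ofInjective (initialValues p) hinj
  -- The monodromy operator on the plane of initial values.
  set M : (initialValues p).range →ₗ[ℝ] (initialValues p).range :=
    e.toLinearMap ∘ₗ translation hT ∘ₗ e.symm.toLinearMap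
  have hMc : Continuous M := M.continuous_of_finiteDimensional
  set Q : (initialValues p).range → ℝ := fun x =>
    x.1.1 * (M x).1.2 - x.1.2 * (M x).1.1
  have hQc : Continuous Q := by fun_prop
  have hQe : ∀ ξ : solutionSpace p, Q (e ξ) = ξ.1 0 * deriv ξ.1 T - deriv ξ.1 0 * ξ.1 T := by
    intro ξ
    have hM : M (e ξ) = e (translation hT ξ) := by simp [M]
    have h2 : (e (translation hT ξ)).1 = (ξ.1 T, deriv ξ.1 T) := by
      refine Prod.ext ?_ ?_
      · change ξ.1 (0 + T) = _
        rw [zero_add]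
      · change deriv (fun t => ξ.1 (t + T)) 0 = _
        simp only [(ξ.2.shift hT).2, zero_add]
    simp only [Q, hM, h2]
    rfl
  have hhom : ∀ (c : ℝ) x, Q (c • x) = c ^ 2 * Q x := by
    intro c x
    simp only [Q, map_smul, Submodule.coe_smul, Prod.smul_fst, Prod.smul_snd, smul_eq_mul]
    ring
  have hne : ∀ x, x ≠ 0 → Q x ≠ 0 := by
    intro x hx hQx
    obtain ⟨ξ, rfl⟩ := e.surjective x
    rw [hQe] at hQx
    have hξ0 : ξ.1 ≠ 0 := fun h => hx (by rw [show ξ = 0 from Subtype.ext h, map_zero])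
    have hinit : ξ.1 0 ≠ 0 ∨ deriv ξ.1 0 ≠ 0 := by
      by_contra! hcon
      exact hξ0 (ξ.2.eq_zero hK hcon.1 hcon.2)
    -- The initial values of the translate are `c` times those of `ξ`.
    obtain ⟨c, hc1, hc2⟩ : ∃ c, ξ.1 T = c * ξ.1 0 ∧ deriv ξ.1 T = c * deriv ξ.1 0 := by
      rcases hinit with h | h
      · refine ⟨ξ.1 T / ξ.1 0, by field_simp, ?_⟩
        field_simp
        linarith
      · refine ⟨deriv ξ.1 T / deriv ξ.1 0, ?_, by field_simp⟩
        field_simp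
        linarith
    have hs := ξ.2.shift hT
    have hc := ξ.2.const_mul (-c)
    have hz := hs.1.add hc.1
    have h0 := hz.1.eq_zero hK (a := 0) (by simp [hc1])
      (by rw [hz.2, hs.2, hc.2]; simp [hc2])
    refine hno c ξ.1 ξ.2 hξ0 fun t => ?_
    have := congrFun h0 t
    simp only [Pi.zero_apply] at this
    linarith
  obtain ⟨A, hA, hAQ⟩ := exists_le_mul_sq_norm hQc hhom hne
  intro ε hε
  set G := 2 * A * Real.exp ((1 + K) * T) with hG
  have hG0 : 0 < G := by positivity
  refine ⟨ε / √G, div_pos hε (Real.sqrt_pos.2 hG0), fun ξ hξ h1 h2 t => ?_⟩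
  set n := ⌊t / T⌋
  have hnt : (n : ℝ) * T ≤ t := (le_div_iff₀ hT0).1 (Int.floor_le _)
  have htn : t - n * T ≤ T := by
    have := (div_lt_iff₀ hT0).1 (Int.lt_floor_add_one (t / T))
    linarith
  have hTn : Function.Periodic p (n * T) := hT.int_mul n
  have hξn := hξ.shift hTn
  have hexp := (hξ.sq_add_sq_le hK hnt).1
  have hshift := hξ.shift hT
  have hinv : Q (e ⟨_, hξn.1⟩) = Q (e ⟨ξ, hξ⟩) := by
    rw [hQe, hQe]
    have := hξ.wronskian_eq hshift.1 (n * T) 0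
    simp only [hshift.2, hξn.2, zero_add] at this ⊢
    rw [add_comm T]
    exact this
  have hnorm := hAQ _ _ (congrArg abs hinv)
  have hlt : max |ξ 0| |deriv ξ 0| < ε / √G := max_lt h1 h2
  have hle : ‖e ⟨ξ, hξ⟩‖ ^ 2 < (ε / √G) ^ 2 := by
    refine pow_lt_pow_left₀ ?_ (norm_nonneg _) two_ne_zero
    exact hlt
  have hge : ξ (n * T) ^ 2 + deriv ξ (n * T) ^ 2 ≤ 2 * ‖e ⟨_, hξn.1⟩‖ ^ 2 := by
    have e1 : |ξ (n * T)| ≤ ‖e ⟨_, hξn.1⟩‖ := by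
      refine le_trans (le_of_eq ?_) (norm_fst_le (e ⟨_, hξn.1⟩).1)
      change _ = |ξ (0 + n * T)|
      rw [zero_add]
    have e2 : |deriv ξ (n * T)| ≤ ‖e ⟨_, hξn.1⟩‖ := by
      refine le_trans (le_of_eq ?_) (norm_snd_le (e ⟨_, hξn.1⟩).1)
      change _ = |deriv (fun t => ξ (t + n * T)) 0|
      simp only [hξn.2, zero_add]
    rw [← sq_abs (ξ _), ← sq_abs (deriv ξ _)]
    have := pow_le_pow_left₀ (abs_nonneg _) e1 2
    have := pow_le_pow_left₀ (abs_nonneg _) e2 2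
    linarith
  have hK0 : 0 ≤ K := (abs_nonneg _).trans (hK 0)
  have hexp' : Real.exp ((1 + K) * (t - n * T)) ≤ Real.exp ((1 + K) * T) :=
    Real.exp_le_exp.2 (mul_le_mul_of_nonneg_left htn (by linarith))
  have hfin : ξ t ^ 2 + deriv ξ t ^ 2 < ε ^ 2 := by
    calc ξ t ^ 2 + deriv ξ t ^ 2
        ≤ (ξ (n * T) ^ 2 + deriv ξ (n * T) ^ 2) * Real.exp ((1 + K) * (t - n * T)) := hexp
      _ ≤ (2 * (A * ‖e ⟨ξ, hξ⟩‖ ^ 2)) * Real.exp ((1 + K) * T) := by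
        gcongr
        exact hge.trans (by linarith)
      _ = G * ‖e ⟨ξ, hξ⟩‖ ^ 2 := by rw [hG]; ring
      _ < G * (ε / √G) ^ 2 := by gcongr
      _ = ε ^ 2 := by rw [div_pow, Real.sq_sqrt hG0.le]; field_simp
  constructor
  · exact abs_lt_of_sq_lt_sq (by nlinarith [sq_nonneg (deriv ξ t)]) hε.le
  · exact abs_lt_of_sq_lt_sq (by nlinarith [sq_nonneg (ξ t)]) hε.le

end IsHillSolution

/-! ### Zeros of Floquet solutions -/

namespace IsHillSolution

variable {p ξ : ℝ → ℝ}

/-- A Floquet solution with `ℓ ≥ 1` zeros per period `T` has a zero, and Sturm comparison with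
constants `m² ≤ p ≤ M²` gives `m ≤ ℓ π / T ≤ M`. -/
theorem exists_zero_and_mul_period_bounds (h : IsHillSolution p ξ) {K : ℝ}
    (hK : ∀ t, |p t| ≤ K) (h0 : ξ ≠ 0) {c T : ℝ} (hT0 : 0 < T)
    (hc : ∀ t, ξ (t + T) = c * ξ t) {ℓ : ℕ} (hℓ : 1 ≤ ℓ)
    (hcard : {t ∈ Ico 0 T | ξ t = 0}.encard = ℓ) :
    ∃ a, ξ a = 0 ∧
      (∀ m : ℝ, 0 < m → (∀ t, m ^ 2 ≤ p t) → m * T ≤ ℓ * Real.pi) ∧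
      (∀ M : ℝ, 0 ≤ M → (∀ t, p t ≤ M ^ 2) → ℓ * Real.pi ≤ M * T) := by
  have hc0 : c ≠ 0 := by
    rintro rfl
    exact h0 (funext fun t => by simpa using hc (t - T))
  have hfin : {t ∈ Ico 0 T | ξ t = 0}.Finite := finite_of_encard_eq_coe hcard
  set S := hfin.toFinset with hS
  have hmem : ∀ t, t ∈ S ↔ (0 ≤ t ∧ t < T) ∧ ξ t = 0 := fun t => by simp [hS]
  have hScard : S.card = ℓ := by
    rw [hfin.encard_eq_coe_toFinset_card] at hcard
    exact_mod_cast hcard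
  have hne : S.Nonempty := Finset.card_pos.1 (by omega)
  -- Let `a` be the smallest zero in `[0, T)`, so that `[0, T)` and `[a, a + T)` have the same zeros.
  set a := S.min' hne with ha
  have haS : a ∈ S := S.min'_mem hne
  have hmin : ∀ t ∈ S, a ≤ t := fun t ht => S.min'_le t ht
  have ha0 := (hmem a).1 haS
  have hmem' : ∀ t, a ≤ t → t < a + T → ξ t = 0 → t ∈ S := by
    intro t h1 h2 h3
    refine (hmem t).2 ⟨⟨by linarith [ha0.1.1], ?_⟩, h3⟩
    by_contra! hle
    have h4 : ξ (t - T) = 0 := by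
      have := hc (t - T)
      rw [sub_add_cancel, h3] at this
      exact (mul_eq_zero.1 this.symm).resolve_left hc0
    have := hmin (t - T) ((hmem _).2 ⟨⟨by linarith, by linarith [ha0.1.2]⟩, h4⟩)
    linarith
  have hℓ0 : (0 : ℝ) < ℓ := by exact_mod_cast hℓ
  refine ⟨a, ha0.2, fun m hm hp => ?_, fun M hM hp => ?_⟩
  · by_contra! hlt
    -- Each of the `ℓ` subintervals of length `T / ℓ > π / m` contains a zero in its interior.
    have hlen : Real.pi / m < T / ℓ := by
      rw [div_lt_div_iff₀ hm hℓ0]; linarith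
    choose z hz hz0 using fun k : ℕ => h.exists_zero_mem_Ioc hm hp (a + k * (T / ℓ))
    have hz1 : ∀ k, a + k * (T / ℓ) < z k := fun k => (hz k).1
    have hz2 : ∀ k : ℕ, z k < a + (k + 1 : ℕ) * (T / ℓ) := fun k => by
      push_cast; linarith [(hz k).2]
    have hmono : ∀ i j : ℕ, i ≤ j → a + i * (T / ℓ) ≤ a + j * (T / ℓ) := fun i j hij => by
      have : (0 : ℝ) < T / ℓ := by positivity
      gcongr
    have hle : (Finset.range ℓ).card ≤ (S.erase a).card := by
      refine Finset.card_le_card_of_injOn z (fun k hk => ?_) fun i _ j _ hij => ?_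
      · have h1 := hmono 0 k (Nat.zero_le _)
        rw [Nat.cast_zero, zero_mul, add_zero] at h1
        have h2 := hmono (k + 1) ℓ (by simpa using hk)
        rw [mul_div_cancel₀ _ hℓ0.ne'] at h2
        exact Finset.mem_erase.2 ⟨by linarith [hz1 k] |> fun h : a < z k => h.ne',
          hmem' _ (by linarith [hz1 k]) (by linarith [hz2 k]) (hz0 k)⟩
      · rcases lt_trichotomy i j with hlt | heq | hgt
        · linarith [hz2 i, hz1 j, hmono _ _ (Nat.succ_le_of_lt hlt)]
        · exact heq
        · linarith [hz2 j, hz1 i, hmono _ _ (Nat.succ_le_of_lt hgt)]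
    rw [Finset.card_range, Finset.card_erase_of_mem haS, hScard] at hle
    omega
  · -- The `ℓ` zeros in `[a, a + T)` and `a + T` are separated by `π / M`.
    have hπ := Real.pi_pos
    have hgap : ∀ s t, ξ s = 0 → ξ t = 0 → s < t →
        M * (s - a) / Real.pi + 1 ≤ M * (t - a) / Real.pi := fun s t hs ht hst => by
      rw [← sub_nonneg]
      have e : M * (t - a) / Real.pi - (M * (s - a) / Real.pi + 1) =
          (M * (t - s) - Real.pi) / Real.pi := by field_simp; ring
      rw [e]
      exact div_nonneg (by linarith [h.pi_le_mul_sub hK h0 hM hp hst hs ht]) hπ.le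
    have hpos : ∀ t ∈ S, 0 ≤ M * (t - a) / Real.pi := fun t ht =>
      div_nonneg (mul_nonneg hM (by linarith [hmin t ht])) hπ.le
    have hle : S.card ≤ (Finset.range ⌊M * T / Real.pi⌋₊).card := by
      refine Finset.card_le_card_of_injOn (fun t => ⌊M * (t - a) / Real.pi⌋₊)
        (fun t ht => ?_) fun s hs t ht hst => ?_
      · have h1 := (hmem t).1 ht
        have h2 := hgap t (a + T) h1.2 (by rw [hc, ha0.2, mul_zero]) (by linarith [ha0.1.1])
        rw [add_sub_cancel_left] at h2
        have h3 := Nat.floor_mono h2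
        rw [Nat.floor_add_one (hpos t ht)] at h3
        exact Finset.mem_coe.2 (Finset.mem_range.2 h3)
      · have hfl : ∀ u ∈ S, ∀ v ∈ S, u < v →
            ⌊M * (u - a) / Real.pi⌋₊ < ⌊M * (v - a) / Real.pi⌋₊ := fun u hu v hv huv => by
          have := Nat.floor_mono (hgap u v ((hmem u).1 hu).2 ((hmem v).1 hv).2 huv)
          rwa [Nat.floor_add_one (hpos u hu)] at this
        rcases lt_trichotomy s t with hlt | heq | hgt
        · exact absurd hst (hfl s hs t ht hlt).ne
        · exact heq
        · exact absurd hst (hfl t ht s hs hgt).ne'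
    rw [hScard, Finset.card_range] at hle
    have h1 : (ℓ : ℝ) ≤ M * T / Real.pi :=
      (Nat.cast_le.2 hle).trans (Nat.floor_le (by positivity))
    rwa [le_div_iff₀ hπ] at h1

end IsHillSolution

/-! ### Resonance tongues and stability -/

namespace IsDuffingSolution

variable {δ γ : ℝ} {y : ℝ → ℝ}

theorem abs_sub_le_of_isFloquetSolution (h : IsDuffingSolution δ y) (hδ : 0 < δ)
    (hδ1 : δ < 1 / 5) {ℓ : ℕ} (hℓ : 2 ≤ ℓ) {c : ℝ} {ξ : ℝ → ℝ}
    (hξ : IsFloquetSolution (fun t => γ + y t ^ 2) ℓ c ξ) :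
    |γ - ℓ ^ 2 - (3 * ℓ ^ 2 / 4 - 1 / 2) * δ ^ 2| ≤
      (32 * Real.pi + 84 * Real.pi * ℓ ^ 2) * δ ^ 4 := by
  obtain ⟨hsol, h0, T, hper, hc, hcard⟩ := hξ
  obtain ⟨hT0, hT1, hT⟩ := h.smallest_period_bound hper
  obtain ⟨a, ha, hlow, hup⟩ := hsol.exists_zero_and_mul_period_bounds (h.abs_add_sq_le γ) h0 hT0
    hc (by omega) hcard
  set ω := Real.pi / T
  have hω : ω * T = Real.pi := div_mul_cancel₀ _ hT0.ne'
  have hω0 : 0 < ω := div_pos Real.pi_pos hT0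
  have hℓ0 : (0 : ℝ) < ℓ := by exact_mod_cast (by omega : 0 < ℓ)
  have h1 : γ ≤ (ℓ * ω) ^ 2 := by
    rcases le_or_gt γ 0 with hγ | hγ
    · exact hγ.trans (sq_nonneg _)
    · have h2 := hlow (√γ) (Real.sqrt_pos.2 hγ) fun t => by
        rw [Real.sq_sqrt hγ.le]; linarith [sq_nonneg (y t)]
      rw [← hω, ← mul_assoc] at h2
      exact (Real.sqrt_le_left (by positivity)).1 (le_of_mul_le_mul_right h2 hT0)
  have h2 : (ℓ * ω) ^ 2 ≤ γ + δ ^ 2 := by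
    have h3 := hup (√(max (γ + δ ^ 2) 0)) (Real.sqrt_nonneg _) fun t => by
      rw [Real.sq_sqrt (le_max_right _ _)]
      exact le_max_of_le_left (by linarith [h.sq_le t])
    rw [← hω, ← mul_assoc] at h3
    have h4 := (Real.le_sqrt' (by positivity)).1 (le_of_mul_le_mul_right h3 hT0)
    exact (le_max_iff.1 h4).resolve_right (not_le.2 (by positivity))
  have := h.abs_dirichlet_eigenvalue_sub_le hδ hδ1.le hT0 hT1 hT hω hℓ (B := 1)
    (abs_le.2 ⟨by linarith, by nlinarith⟩) (by nlinarith [Real.pi_lt_d2, Real.pi_pos])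
    hsol h0 ha (by rw [hc, ha, mul_zero])
  linarith

/-- For stability at small amplitudes `δ` it suffices to exclude Dirichlet eigenfunctions on the
intervals `[a, a + T]`, since all solutions have zeros. -/
theorem trivialSolutionStable_of_forall_zero (h : IsDuffingSolution δ y) (hδ : 0 < δ)
    (hγ : 0 ≤ γ)
    (hno : ∀ T, 0 < T → T ≤ Real.pi → deriv y T = 0 → ∀ ξ a,
      IsHillSolution (fun t => γ + y t ^ 2) ξ → ξ ≠ 0 → ξ a = 0 → ξ (a + T) ≠ 0) :
    TrivialSolutionStable fun t => γ + y t ^ 2 := by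
  obtain ⟨T, hT0, hT1, hT⟩ := h.exists_velocity_eq_zero
  refine IsHillSolution.trivialSolutionStable (h.abs_add_sq_le γ) hT0
    (fun t => congrArg (γ + ·) (h.periodic_of_velocity_eq_zero hT t)) fun c ξ hξ h0 hc => ?_
  obtain ⟨a, ha⟩ := hξ.exists_zero (fun t => by positivity) (t₀ := 0)
    (by rw [h.init]; positivity)
  exact hno T hT0 hT1 hT ξ a hξ h0 ha (by rw [hc, ha, mul_zero])

theorem trivialSolutionStable_zero (h : IsDuffingSolution δ y) (hδ : 0 < δ) (hδ1 : δ < 1) :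
    TrivialSolutionStable fun t => 0 + y t ^ 2 := by
  refine h.trivialSolutionStable_of_forall_zero hδ le_rfl fun T hT0 hT1 _ ξ a hξ h0 ha hb => ?_
  have := hξ.pi_le_mul_sub (h.abs_add_sq_le 0) h0 hδ.le (fun t => by linarith [h.sq_le t])
    (by linarith : a < a + T) ha hb
  nlinarith

theorem trivialSolutionStable_natCast_sq {ℓ : ℕ} (hℓ : 2 ≤ ℓ) :
    ∃ δ₀ > (0 : ℝ), ∀ δ, 0 < δ → δ < δ₀ → ∀ y, IsDuffingSolution δ y →
      TrivialSolutionStable fun t => (ℓ : ℝ) ^ 2 + y t ^ 2 := by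
  have hπ := Real.pi_pos
  have hℓ2 : (2 : ℝ) ≤ ℓ := by exact_mod_cast hℓ
  set B : ℝ := 3 * ℓ ^ 2
  set C : ℝ := 4 * Real.pi * (B + 1) ^ 2 + 16 * Real.pi + 84 * Real.pi * ℓ ^ 2
  set D : ℝ := C + (B + 1) * Real.pi
  have hB : 0 ≤ B := by positivity
  have hC : 0 ≤ C := by positivity
  have hBπ : 0 ≤ (B + 1) * Real.pi := by positivity
  have hD : 0 ≤ D := by positivity
  refine ⟨1 / (D + 5), by positivity, fun δ hδ hδ1 y h => ?_⟩
  rw [lt_div_iff₀ (by positivity)] at hδ1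
  have hδ5 : δ ≤ 1 / 5 := by nlinarith
  have hDδ : D * δ ^ 2 < 1 := by nlinarith [mul_nonneg hD hδ.le]
  refine h.trivialSolutionStable_of_forall_zero hδ (by positivity)
    fun T hT0 hT1 hT ξ a hξ h0 ha hb => ?_
  have hω : Real.pi / T * T = Real.pi := div_mul_cancel₀ _ hT0.ne'
  obtain ⟨-, h2, h3⟩ := h.frequency_bound hδ hT0 hT1 hT hω
  have hδ2 := sq_nonneg δ
  have := h.abs_dirichlet_eigenvalue_sub_le hδ hδ5 hT0 hT1 hT hω hℓ (B := B)
    (by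
      have h4 : 0 ≤ (ℓ : ℝ) ^ 2 := sq_nonneg _
      rw [mul_pow, abs_le]
      constructor <;> nlinarith) (by nlinarith) hξ h0 ha hb
  rw [sub_self, zero_sub, abs_neg] at this
  -- The first-order shift of the eigenvalue exceeds the error term.
  have h5 : C * δ ^ 4 ≤ 1 * δ ^ 2 := by
    rw [show C * δ ^ 4 = (C * δ ^ 2) * δ ^ 2 by ring]
    gcongr
    nlinarith
  have h6 := (le_abs_self _).trans (this.trans h5)
  have h7 : 0 < δ ^ 2 := by positivity
  have h8 := le_of_mul_le_mul_right h6 h7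
  nlinarith

/-- Away from the squares of integers, `sin (√γ π) ≠ 0` excludes Dirichlet eigenfunctions on
`[a, a + T]` for `T` close to `π`. -/
theorem trivialSolutionStable_of_sin_ne_zero (hγ : 0 < γ)
    (hsin : Real.sin (√γ * Real.pi) ≠ 0) :
    ∃ δ₀ > (0 : ℝ), ∀ δ, 0 < δ → δ < δ₀ → ∀ y, IsDuffingSolution δ y →
      TrivialSolutionStable fun t => γ + y t ^ 2 := by
  have hπ := Real.pi_pos
  set k := √γ
  have hk : 0 < k := Real.sqrt_pos.2 hγ
  have hk2 : k ^ 2 = γ := Real.sq_sqrt hγ.le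
  set σ := |Real.sin (k * Real.pi)| with hσ
  have hσ0 : 0 < σ := abs_pos.2 hsin
  set A := (2 * Real.pi / k + 3 * Real.pi * k) / σ
  have hA : 0 ≤ A := by positivity
  set B := 2 * Real.pi / k
  have hB : 0 ≤ B := by positivity
  refine ⟨1 / (A + B + 1), by positivity, fun δ hδ hδ1 y h => ?_⟩
  rw [lt_div_iff₀ (by positivity)] at hδ1
  have hδ2 : δ ≤ 1 := by nlinarith
  have hAB : (A + B) * δ ^ 2 < 1 := by nlinarith [mul_nonneg (add_nonneg hA hB) hδ.le]
  have hAδ : A * δ ^ 2 < 1 := by nlinarith [mul_nonneg hB (sq_nonneg δ)]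
  have hBδ : B * δ ^ 2 < 1 := by nlinarith [mul_nonneg hA (sq_nonneg δ)]
  refine h.trivialSolutionStable_of_forall_zero hδ hγ.le
    fun T hT0 hT1 hT ξ a hξ h0 ha hb => ?_
  have hω : Real.pi / T * T = Real.pi := div_mul_cancel₀ _ hT0.ne'
  obtain ⟨h1, h2, h3⟩ := h.frequency_bound hδ hT0 hT1 hT hω
  have hda := hξ.deriv_ne_zero (h.abs_add_sq_le γ) h0 ha
  obtain ⟨hζ, hζ'⟩ := hξ.const_mul (k / deriv ξ a)
  have hsmall : 2 * δ ^ 2 * (a + T - a) ≤ k := by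
    have e : B * δ ^ 2 * k = 2 * Real.pi * δ ^ 2 := by simp only [B]; field_simp
    rw [add_sub_cancel_left]
    nlinarith [mul_le_mul_of_nonneg_left hT1 (sq_nonneg δ)]
  have hbd := hζ.abs_sub_sin_le hk (ε := δ ^ 2) (b := a + T) (fun t _ => by
      rw [hk2, add_sub_cancel_left, abs_of_nonneg (sq_nonneg _)]
      exact h.sq_le t) hsmall (by simp [ha]) (by rw [hζ']; field_simp)
    (right_mem_Icc.2 (by linarith))
  rw [hb, mul_zero, zero_sub, abs_neg, add_sub_cancel_left] at hbd
  have hTπ : Real.pi - T ≤ 3 * Real.pi * δ ^ 2 := by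
    have e : Real.pi - T = (Real.pi / T - 1) * T := by rw [sub_mul, hω, one_mul]
    have h4 : Real.pi / T - 1 ≤ 3 * δ ^ 2 := by nlinarith
    rw [e]
    calc _ ≤ 3 * δ ^ 2 * Real.pi := by gcongr
      _ = _ := by ring
  have hlip : |Real.sin (k * Real.pi) - Real.sin (k * T)| ≤ k * (Real.pi - T) := by
    have := Real.lipschitzWith_sin.dist_le_mul (k * Real.pi) (k * T)
    rwa [NNReal.coe_one, one_mul, Real.dist_eq, Real.dist_eq, ← mul_sub,
      abs_of_nonneg (mul_nonneg hk.le (by linarith))] at this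
  have hσle : σ ≤ (2 * Real.pi / k + 3 * Real.pi * k) * δ ^ 2 := by
    calc σ = |(Real.sin (k * Real.pi) - Real.sin (k * T)) + Real.sin (k * T)| := by
          rw [sub_add_cancel]
      _ ≤ _ := abs_add_le _ _
      _ ≤ k * (3 * Real.pi * δ ^ 2) + 2 * δ ^ 2 * Real.pi / k := by
          refine add_le_add (hlip.trans ?_) (hbd.trans ?_) <;> gcongr
      _ = _ := by ring
  have e : A * δ ^ 2 * σ = (2 * Real.pi / k + 3 * Real.pi * k) * δ ^ 2 := by
    simp only [A]; field_simp
  nlinarith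

end IsDuffingSolution

theorem theorem3p6 :
    (∀ ℓ : ℕ, 2 ≤ ℓ → ∃ C > (0 : ℝ), ∃ δ₀ > (0 : ℝ), ∀ δ γ : ℝ,
      (δ, γ) ∈ resonanceTongue ℓ ∪ resonanceLines ℓ → δ < δ₀ →
        (ℓ : ℝ) ^ 2 + (3 * (ℓ : ℝ) ^ 2 / 4 - 1 / 2 - 1 / (Real.pi * ℓ)) * δ ^ 2 - C * δ ^ 4 ≤ γ ∧
        γ ≤ (ℓ : ℝ) ^ 2 + (3 * (ℓ : ℝ) ^ 2 / 4 - 1 / 2 + 1 / (Real.pi * ℓ)) * δ ^ 2 + C * δ ^ 4) ∧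
    (∀ γ : ℝ, 0 ≤ γ → γ ≠ 1 → ∃ δγ > (0 : ℝ), ∀ δ : ℝ, 0 < δ → δ < δγ →
      ∀ y : ℝ → ℝ, IsDuffingSolution δ y → TrivialSolutionStable (fun t => γ + y t ^ 2)) := by
  have hπ := Real.pi_pos
  constructor
  · intro ℓ hℓ
    refine ⟨32 * Real.pi + 84 * Real.pi * ℓ ^ 2, by positivity, 1 / 5, by norm_num,
      fun δ γ hmem hδ1 => ?_⟩
    obtain ⟨hδ, y, hy, c, ξ, hξ⟩ : 0 < δ ∧ ∃ y, IsDuffingSolution δ y ∧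
        ∃ c ξ, IsFloquetSolution (fun t => γ + y t ^ 2) ℓ c ξ := by
      rcases hmem with ⟨hδ, y, hy, c, ξ, -, hξ⟩ | ⟨hδ, y, hy, c, ξ, -, hξ⟩ <;>
        exact ⟨hδ, y, hy, c, ξ, hξ⟩
    have h1 := abs_le.1 (hy.abs_sub_le_of_isFloquetSolution hδ hδ1 hℓ hξ)
    have h2 : 0 ≤ 1 / (Real.pi * ℓ) * δ ^ 2 := by positivity
    constructor <;> linarith
  · intro γ hγ0 hγ1
    rcases hγ0.eq_or_lt with rfl | hγ
    · exact ⟨1, one_pos, fun δ hδ hδ1 y hy => hy.trivialSolutionStable_zero hδ hδ1⟩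
    by_cases hsin : Real.sin (√γ * Real.pi) = 0
    · obtain ⟨n, hn⟩ := Real.sin_eq_zero_iff.1 hsin
      have hn' : (n : ℝ) = √γ := mul_right_cancel₀ hπ.ne' hn
      have hn0 : 0 < n := by
        have := Real.sqrt_pos.2 hγ
        rw [← hn'] at this
        exact_mod_cast this
      lift n to ℕ using hn0.le
      have hsq : γ = (n : ℝ) ^ 2 := by
        rw [← Real.sq_sqrt hγ0, ← hn']; norm_cast
      have hne : n ≠ 1 := by
        rintro rfl
        exact hγ1 (by simpa using hsq)
      rw [hsq]
      exact IsDuffingSolution.trivialSolutionStable_natCast_sq (by omega)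
    · exact IsDuffingSolution.trivialSolutionStable_of_sin_ne_zero hγ hsin
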